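/- Let $d\ge 1$ and $p\in(0,1)$, and put $q:=1-p$. For $n\ge 3$ consider the lattice of the $n^d$ closed unit cubes $[0,1]^d+z$, $z\in\{0,\dots,n-1\}^d$, on the torus obtained from $[0,n]^d$ by identifying opposite faces. Let $(X_z)_{z\in\{0,\dots,n-1\}^d}$ be independent random variables with $P(X_z=1)=p$ and $P(X_z=-1)=q$. The voxel model $\mathcal C$ is the union of the closed cubes $[0,1]^d+z$ that remain when every cube with $X_z=-1$ is removed. For integers $j,\delta\ge 0$ let $V_j(\delta):=(-1)^{\delta-j}\binom{\delta}{j}$ (which is $0$ if $j>\delta$) be the $j$-th intrinsic volume of an open $\delta$-dimensional unit cube. For $j=0,\dots,d$ define the $j$-th intrinsic volume of $\mathcal C$ by $$V_j(\mathcal C):=\sum_{D}V_j(\dim D)\,\mathbf 1\{D\subseteq\mathcal C\},$$ where $D$ runs over all open cubes, of dimensions $0,1,\dots,d$, of the lattice on the torus. Let $$\mathbf V:=\Big(n^{-d/2}\big(V_j(\mathcal C)-\mathbb E[V_j(\mathcal C)]\big)\Big)_{j=0}^{d}.$$ Let $\Sigma=(c(i,j))_{i,j=0}^d$, where $$c(i,j)=\sum_{a=0}^d\sum_{b=0}^d\sum_{\delta=0}^d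 V_i(a)V_j(b)\binom d\delta N_{a,b,\delta}\,q^{2^{d-a}+2^{d-b}}\big(q^{-2^{d-\delta}}-1\big),$$ $$N_{a,b,\delta}=\sum_{\ell=0}^\delta(-1)^{\delta-\ell}\binom\delta\ell\binom\ell a\binom\ell b2^{\delta+\ell-a-b}.$$ For random vectors $\mathbf X,\mathbf Y$ in $\mathbb R^{m}$, let $d_4(\mathbf X,\mathbf Y):=\sup_g|\mathbb E[g(\mathbf X)]-\mathbb E[g(\mathbf Y)]|$, where the supremum runs over all four times partially differentiable functions $g:\mathbb R^{m}\to\mathbb R$ whose partial derivatives of orders $1,2,3,4$ are all bounded by $1$ in absolute value. Then $\Sigma$ is symmetric and positive semidefinite, so that there is a $(d+1)$-dimensional centred Gaussian random vector $\mathbf N_\Sigma$ with covariance matrix $\Sigma$, and there is a constant $C=C(p,d)$, depending only on $p$ and $d$, such that for all $n\ge 3$ $$d_4(\mathbf V,\mathbf N_\Sigma)\le \frac{C}{n^{d/2}}.$$ -/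

import Mathlib

open MeasureTheory ProbabilityTheory
open scoped ENNReal

noncomputable section

namespace RandomCubical

/-! ### The `d₄`-distance -/

section Distance

variable {ι : Type*} [Fintype ι] [DecidableEq ι]

/-- The partial derivative `∂g/∂xᵢ` of `g : ℝ^ι → ℝ`. -/
def partialDeriv (i : ι) (g : EuclideanSpace ℝ ι → ℝ) (x : EuclideanSpace ℝ ι) : ℝ :=
  lineDeriv ℝ g x (EuclideanSpace.single i 1)

/-- The iterated partial derivative `∂ᵏg / ∂x_{i₁} … ∂x_{iₖ}`, for the list `[i₁, …, iₖ]`. -/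
def iterPartialDeriv : List ι → (EuclideanSpace ℝ ι → ℝ) → EuclideanSpace ℝ ι → ℝ
  | [], g => g
  | i :: l, g => partialDeriv i (iterPartialDeriv l g)

/-- `g` is `m` times partially differentiable: every iterated partial derivative of order
at most `m` exists at every point. -/
def PartiallyDifferentiable (m : ℕ) (g : EuclideanSpace ℝ ι → ℝ) : Prop :=
  ∀ l : List ι, l.length < m → ∀ (i : ι) (x : EuclideanSpace ℝ ι),
    LineDifferentiableAt ℝ (iterPartialDeriv l g) x (EuclideanSpace.single i 1)

/-- `M_k(g)`: the largest supremum norm of a partial derivative of order `k`, as a number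
in `[0, ∞]`. -/
def maxPartialDeriv (k : ℕ) (g : EuclideanSpace ℝ ι → ℝ) : ℝ≥0∞ :=
  ⨆ (s : Fin k → ι) (x : EuclideanSpace ℝ ι), ‖iterPartialDeriv (List.ofFn s) g x‖ₑ

/-- The test functions of the `d₄`-distance. -/
def IsTestFunction (g : EuclideanSpace ℝ ι → ℝ) : Prop :=
  PartiallyDifferentiable 4 g ∧ ∀ k ∈ Finset.Icc 1 4, maxPartialDeriv k g ≤ 1

/-- The `d₄`-distance between two laws on `ℝ^ι` with finite first moments (test functions are
Lipschitz, hence integrable for such laws), as a number in `[0, ∞]`. -/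
def dFour (μ ν : Measure (EuclideanSpace ℝ ι)) : ℝ≥0∞ :=
  ⨆ (g : EuclideanSpace ℝ ι → ℝ) (_ : IsTestFunction g),
    ENNReal.ofReal |∫ x, g x ∂μ - ∫ x, g x ∂ν|

end Distance

/-! ### The cubical lattice on the torus and the voxel model -/

/-- The torus obtained from `[0,n]^d` by identifying opposite faces. -/
abbrev Torus (d n : ℕ) : Type := Fin d → AddCircle (n : ℝ)

/-- The closed unit cube `z + [0,1]^d` in the torus. The `n ^ d` cubes of the lattice are
indexed by their corners `z ∈ {0, …, n-1}^d`. -/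
def closedCube {d n : ℕ} (z : Fin d → Fin n) : Set (Torus d n) :=
  {x | ∀ i, x i ∈ ((↑) : ℝ → AddCircle (n : ℝ)) '' Set.Icc ((z i : ℕ) : ℝ) ((z i : ℕ) + 1)}

/-- The open cubes of the lattice, of all dimensions `0, …, d`: the cube with corner
`v ∈ {0, …, n-1}^d` that extends in the coordinate directions in `S`; its dimension is `|S|`. -/
def openCube {d n : ℕ} (v : Fin d → Fin n) (S : Finset (Fin d)) : Set (Torus d n) :=
  {x | ∀ i, x i ∈ ((↑) : ℝ → AddCircle (n : ℝ)) ''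
    (if i ∈ S then Set.Ioo ((v i : ℕ) : ℝ) ((v i : ℕ) + 1) else {((v i : ℕ) : ℝ)})}

/-- The `j`-th intrinsic volume `(-1)^(δ-j) * (δ choose j)` of an open `δ`-cube
(it is `0` for `j > δ`). -/
def openCubeVolume (j δ : ℕ) : ℝ := (-1) ^ (δ - j) * (δ.choose j : ℝ)

open scoped Classical in
/-- The `j`-th intrinsic volume of a union `A` of open cubes of the lattice: the sum of the
`j`-th intrinsic volumes of the open cubes of the lattice that belong to `A`. -/
def intrinsicVolume {d n : ℕ} (j : ℕ) (A : Set (Torus d n)) : ℝ :=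
  ∑ v : Fin d → Fin n, ∑ S : Finset (Fin d),
    if openCube v S ⊆ A then openCubeVolume j S.card else 0

/-- The voxel model: the union of the closed cubes that remain when the cubes `z`
with `ε z = -1` are removed. -/
def voxelComplex {d n : ℕ} (ε : (Fin d → Fin n) → ℝ) : Set (Torus d n) :=
  ⋃ (z : Fin d → Fin n) (_ : ε z ≠ -1), closedCube z

/-- The vector of centred intrinsic volumes `V₀, …, V_d` of the voxel model, scaled
by `n^(-d/2)`. -/
def normalizedVolumes {d n : ℕ} {Ω : Type*} [MeasurableSpace Ω] (P : Measure Ω)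
    (X : (Fin d → Fin n) → Ω → ℝ) (ω : Ω) : EuclideanSpace ℝ (Fin (d + 1)) :=
  WithLp.toLp 2 fun j : Fin (d + 1) =>
    (n : ℝ) ^ (-(d : ℝ) / 2) *
      (intrinsicVolume (j : ℕ) (voxelComplex fun z => X z ω) -
        ∫ ω', intrinsicVolume (j : ℕ) (voxelComplex fun z => X z ω') ∂P)

/-! ### The limiting covariance matrix -/

/-- The numbers `N_{a,b,δ}`. -/
def pairCount (a b δ : ℕ) : ℝ :=
  ∑ l ∈ Finset.range (δ + 1), (-1 : ℝ) ^ (δ - l) * (δ.choose l : ℝ) * (l.choose a : ℝ) *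
    (l.choose b : ℝ) * (2 : ℝ) ^ ((δ : ℤ) + l - a - b)

/-- The constants `c(i,j)`, with `q = 1 - p`. -/
def covConst (d : ℕ) (p : ℝ) (i j : ℕ) : ℝ :=
  ∑ a ∈ Finset.range (d + 1), ∑ b ∈ Finset.range (d + 1), ∑ δ ∈ Finset.range (d + 1),
    openCubeVolume i a * openCubeVolume j b * (d.choose δ : ℝ) * pairCount a b δ *
      (1 - p) ^ (2 ^ (d - a) + 2 ^ (d - b)) * (((1 - p) ^ (2 ^ (d - δ)))⁻¹ - 1)

/-- The matrix `Σ = (c(i,j))`, with `i, j = 0, …, d`. -/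
def covMatrix (d : ℕ) (p : ℝ) : Matrix (Fin (d + 1)) (Fin (d + 1)) ℝ :=
  Matrix.of fun i j => covConst d p i j

end RandomCubical

end

/-!
The voxels are removed independently, and a lattice cube belongs to the voxel model unless all the
voxels of its star (the closed voxels that contain it) are removed. So the centred normalized vector
`W` of intrinsic volumes is a sum of `n ^ d` bounded vectors of size `O(n ^ (-d / 2))`, one for each
lattice vertex, and each of them depends only on the `2 ^ d` voxels around its vertex.

*Covariance.* The covariance of the indicators that two stars `A`, `B` are removed is
`q ^ (|A| + |B|) (q ^ (-|A ∩ B|) - 1)`, and `A ∩ B` is empty or the star of the join of the two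
cubes. Counting pairs of cubes by the dimensions of the cubes and of their join factorizes over the
coordinates; for `n ≥ 3` the generating function is `n ^ d (1 + z ((x + 2) (y + 2) - 2)) ^ d`, whose
coefficients are `n ^ d (d choose δ) N_{a,b,δ}` (`pairCount_generating_function`, `sum_pairs_eq`).
Hence `Σ` is exactly the covariance matrix of `W` for every `n ≥ 3`
(`integral_sum_siteVolume_mul`), and in particular positive semidefinite.

*Gaussian approximation.* The function `s ↦ 𝔼 g (s W + √(1 - s²) N)` interpolates between `𝔼 g(N)`
and `𝔼 g(W)`. For a small step from `s` to `t`, stability of the Gaussian law splits off an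
independent Gaussian part of variance `t² - s²`, so the increment is
`(t - s) (𝔼 ⟨W, ∇G(sW)⟩ - s ∑ Σᵢⱼ 𝔼 ∂ᵢ∂ⱼG(sW)) + O((t - s) ^ (3 / 2))` for a Gaussian average `G` of
`g` (`abs_smartPath_sub_le`). The bracket would vanish for a Gaussian `W`. For a sum of locally
dependent vectors it is bounded by the number of summands times the third power of their size
(`IsLocallyDependent.abs_integral_inner_grad_sub_le`), here `O(n ^ d n ^ (-3 d / 2))`. Summing over
ever smaller steps gives the bound. Only Taylor bounds of order three for `g` enter, which follow
from the bounds on the partial derivatives alone (`IsTestFunction.hasTaylorBounds`).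
-/

open MeasureTheory ProbabilityTheory
open scoped ENNReal

noncomputable section

namespace RandomCubical

/-! ### Taylor bounds for test functions -/

section TestFunction

variable {ι : Type*} [DecidableEq ι]

lemma IsTestFunction.abs_iterPartialDeriv_le {g : EuclideanSpace ℝ ι → ℝ} (hg : IsTestFunction g)
    (l : List ι) (hl0 : 1 ≤ l.length) (hl : l.length ≤ 4) (x : EuclideanSpace ℝ ι) :
    |iterPartialDeriv l g x| ≤ 1 := by
  have h := hg.2 l.length (Finset.mem_Icc.2 ⟨hl0, hl⟩)
  rw [maxPartialDeriv] at h
  have h2 := (le_iSup₂ (f := fun (s : Fin l.length → ι) (x : EuclideanSpace ℝ ι) =>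
    ‖iterPartialDeriv (List.ofFn s) g x‖ₑ) (fun i => l.get i) x).trans h
  simp only [List.ofFn_get] at h2
  rw [← ofReal_norm, ENNReal.ofReal_le_one] at h2
  exact h2

lemma IsTestFunction.hasLineDerivAt {g : EuclideanSpace ℝ ι → ℝ} (hg : IsTestFunction g)
    (l : List ι) (hl : l.length < 4) (i : ι) (x : EuclideanSpace ℝ ι) :
    HasLineDerivAt ℝ (iterPartialDeriv l g) (iterPartialDeriv (i :: l) g x) x
      (EuclideanSpace.single i 1) :=
  (hg.1 l hl i x).hasLineDerivAt

end TestFunction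

section Taylor

variable {ι : Type*} [Fintype ι]

lemma abs_apply_le_norm (x : EuclideanSpace ℝ ι) (i : ι) : |x i| ≤ ‖x‖ :=
  PiLp.norm_apply_le x i

lemma sum_abs_le_card_mul_norm (x : EuclideanSpace ℝ ι) :
    ∑ i, |x i| ≤ Fintype.card ι * ‖x‖ := by
  simpa using Finset.sum_le_card_nsmul Finset.univ (fun i => |x i|) ‖x‖
    fun i _ => abs_apply_le_norm x i

lemma norm_le_norm_of_abs_apply_le {x y : EuclideanSpace ℝ ι} (h : ∀ i, |x i| ≤ |y i|) :
    ‖x‖ ≤ ‖y‖ := by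
  rw [EuclideanSpace.norm_eq, EuclideanSpace.norm_eq]
  gcongr with i
  exact h i

/-- `g` has a gradient `g₁` and a Hessian `g₂` in the quantitative sense that the argument needs:
the first three Taylor remainders of `g` and the first two of `g₁` are bounded with constant `K`,
and so are `g₁`, `g₂` and the Lipschitz constant of `g₂`. -/
structure HasTaylorBounds (K : ℝ) (g : EuclideanSpace ℝ ι → ℝ)
    (g₁ : ι → EuclideanSpace ℝ ι → ℝ) (g₂ : ι → ι → EuclideanSpace ℝ ι → ℝ) : Prop where
  abs_sub_le : ∀ x h, |g (x + h) - g x| ≤ K * ‖h‖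
  taylor_two : ∀ x h, |g (x + h) - g x - ∑ i, g₁ i x * h i| ≤ K * ‖h‖ ^ 2
  taylor_three : ∀ x h, |g (x + h) - g x - ∑ i, g₁ i x * h i
    - (∑ i, ∑ j, g₂ i j x * (h i * h j)) / 2| ≤ K * ‖h‖ ^ 3
  abs_grad_le : ∀ i x, |g₁ i x| ≤ K
  abs_grad_sub_le : ∀ i x h, |g₁ i (x + h) - g₁ i x| ≤ K * ‖h‖
  grad_taylor_two : ∀ i x h, |g₁ i (x + h) - g₁ i x - ∑ j, g₂ i j x * h j| ≤ K * ‖h‖ ^ 2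
  abs_hess_le : ∀ i j x, |g₂ i j x| ≤ K
  abs_hess_sub_le : ∀ i j x h, |g₂ i j (x + h) - g₂ i j x| ≤ K * ‖h‖

lemma hasDerivAt_of_forall_hasLineDerivAt {E : Type*} [NormedAddCommGroup E] [NormedSpace ℝ E]
    {f f' : E → ℝ} {v : E} (hf : ∀ x, HasLineDerivAt ℝ f (f' x) x v) (x : E) (t : ℝ) :
    HasDerivAt (fun s : ℝ => f (x + s • v)) (f' (x + t • v)) t := by
  have h := hf (x + t • v)
  rw [HasLineDerivAt, ← sub_self t] at h
  have h2 := HasDerivAt.comp_sub_const t t h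
  refine h2.congr_of_eventuallyEq (Filter.Eventually.of_forall fun s => ?_)
  simp only [sub_smul]
  congr 1
  abel

/-- A function with Lipschitz second partial derivatives has a Taylor expansion of order two with
cubic remainder. -/
lemma abs_taylor_three_le {g : EuclideanSpace ℝ ι → ℝ} {g₁ : ι → EuclideanSpace ℝ ι → ℝ}
    {g₂ : ι → ι → EuclideanSpace ℝ ι → ℝ} {K L : ℝ}
    (h1 : ∀ x h, |g (x + h) - g x - ∑ i, g₁ i x * h i| ≤ K * ‖h‖ ^ 2)
    (h2 : ∀ i x h, |g₁ i (x + h) - g₁ i x - ∑ j, g₂ i j x * h j| ≤ L * ‖h‖ ^ 2) (hL : 0 ≤ L)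
    (x h : EuclideanSpace ℝ ι) :
    |g (x + h) - g x - ∑ i, g₁ i x * h i - (∑ i, ∑ j, g₂ i j x * (h i * h j)) / 2|
      ≤ L * (Fintype.card ι * ‖h‖ ^ 3) := by
  have hd : ∀ t : ℝ, HasDerivAt (fun t : ℝ => g (x + t • h)) (∑ i, g₁ i (x + t • h) * h i) t := by
    intro t
    rw [hasDerivAt_iff_isLittleO_nhds_zero]
    refine Asymptotics.IsBigO.trans_isLittleO (g := fun s : ℝ => s ^ 2) ?_ ?_
    · refine Asymptotics.IsBigO.of_bound (K * ‖h‖ ^ 2) (Filter.Eventually.of_forall fun s => ?_)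
      have := h1 (x + t • h) (s • h)
      rw [norm_smul, mul_pow, Real.norm_eq_abs, sq_abs] at this
      simp only [Real.norm_eq_abs, abs_pow, sq_abs, add_smul, smul_eq_mul, ← add_assoc]
      refine (le_of_eq ?_).trans (this.trans (le_of_eq (by ring)))
      congr 2
      rw [Finset.mul_sum]
      exact Finset.sum_congr rfl fun i _ => by simp; ring
    · simpa using Asymptotics.isLittleO_pow_id (𝕜 := ℝ) (n := 2) (by norm_num)
  set q := ∑ i, ∑ j, g₂ i j x * (h i * h j) with hq
  have hd' : ∀ t ∈ Set.Icc (0 : ℝ) 1, HasDerivWithinAt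
      (fun t : ℝ => g (x + t • h) - t * ∑ i, g₁ i x * h i - t ^ 2 * (q / 2))
      ((∑ i, g₁ i (x + t • h) * h i) - (∑ i, g₁ i x * h i) - t * q) (Set.Icc 0 1) t := by
    intro t _
    have a := (hasDerivAt_id t).mul_const (∑ i, g₁ i x * h i)
    have b := (hasDerivAt_pow 2 t).mul_const (q / 2)
    refine (((hd t).fun_sub a).fun_sub b).hasDerivWithinAt.congr_deriv ?_
    norm_num
    ring
  have hb : ∀ t ∈ Set.Icc (0 : ℝ) 1,
      ‖(∑ i, g₁ i (x + t • h) * h i) - (∑ i, g₁ i x * h i) - t * q‖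
        ≤ L * (Fintype.card ι * ‖h‖ ^ 3) := by
    intro t ht
    have : (∑ i, g₁ i (x + t • h) * h i) - (∑ i, g₁ i x * h i) - t * q
        = ∑ i, (g₁ i (x + t • h) - g₁ i x - ∑ j, g₂ i j x * (t • h) j) * h i := by
      rw [hq, Finset.mul_sum, ← Finset.sum_sub_distrib, ← Finset.sum_sub_distrib]
      refine Finset.sum_congr rfl fun i _ => ?_
      rw [sub_mul, sub_mul, Finset.sum_mul, Finset.mul_sum]
      congr 1
      exact Finset.sum_congr rfl fun j _ => by simp; ring
    rw [this, Real.norm_eq_abs]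
    have hth : ‖t • h‖ ^ 2 ≤ ‖h‖ ^ 2 := by
      gcongr
      rw [norm_smul, Real.norm_eq_abs, abs_of_nonneg ht.1]
      exact mul_le_of_le_one_left (norm_nonneg _) ht.2
    calc _ ≤ ∑ i, |(g₁ i (x + t • h) - g₁ i x - ∑ j, g₂ i j x * (t • h) j) * h i| :=
          Finset.abs_sum_le_sum_abs _ _
      _ ≤ ∑ i, (L * ‖h‖ ^ 2) * |h i| := by
          refine Finset.sum_le_sum fun i _ => ?_
          rw [abs_mul]
          gcongr
          exact (h2 i x _).trans (mul_le_mul_of_nonneg_left hth hL)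
      _ = (L * ‖h‖ ^ 2) * ∑ i, |h i| := by rw [Finset.mul_sum]
      _ ≤ (L * ‖h‖ ^ 2) * (Fintype.card ι * ‖h‖) := by
          gcongr; exact sum_abs_le_card_mul_norm h
      _ = _ := by ring
  have := Convex.norm_image_sub_le_of_norm_hasDerivWithin_le hd' hb (convex_Icc _ _)
    (Set.left_mem_Icc.2 zero_le_one) (Set.right_mem_Icc.2 zero_le_one)
  rw [Real.norm_eq_abs, sub_zero, norm_one, mul_one] at this
  convert this using 2
  simp only [one_smul, zero_smul, add_zero]
  ring

variable [DecidableEq ι]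

/-- Mean value inequality along the coordinate directions: the increment from `x` to `x + h` is
the telescoping sum of increments that change one coordinate at a time, and all intermediate
points stay within distance `‖h‖` of `x`. -/
lemma abs_increment_sub_linear_le {f : EuclideanSpace ℝ ι → ℝ} {f' : ι → EuclideanSpace ℝ ι → ℝ}
    (hf : ∀ i x, HasLineDerivAt ℝ f (f' i x) x (EuclideanSpace.single i 1))
    (x h : EuclideanSpace ℝ ι) (c : ι → ℝ) {B : ℝ} (hB0 : 0 ≤ B)
    (hB : ∀ i u, ‖u‖ ≤ ‖h‖ → |f' i (x + u) - c i| ≤ B) :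
    |f (x + h) - f x - ∑ i, c i * h i| ≤ B * (Fintype.card ι * ‖h‖) := by
  classical
  -- `H s` agrees with `h` on the coordinates in `s` and vanishes elsewhere
  set H : Finset ι → EuclideanSpace ℝ ι := fun s => ∑ i ∈ s, h i • EuclideanSpace.single i 1
    with hH
  have hHapply : ∀ s j, H s j = if j ∈ s then h j else 0 := by
    intro s j
    simp [hH, Finset.sum_apply, Pi.single_apply]
  have hHuniv : H Finset.univ = h := by
    ext j; simp [hHapply]
  have key : ∀ s : Finset ι, |f (x + H s) - f x - ∑ i ∈ s, c i * h i| ≤ ∑ i ∈ s, B * |h i| := by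
    intro s
    induction s using Finset.induction_on with
    | empty => simp [hH]
    | insert a s ha ih =>
      have hins : H (insert a s) = H s + h a • EuclideanSpace.single a 1 := by
        simp [hH, Finset.sum_insert ha, add_comm]
      have hstep : |f (x + H s + h a • EuclideanSpace.single a 1) - f (x + H s) - c a * h a|
          ≤ B * |h a| := by
        have hd : ∀ t ∈ Set.uIcc 0 (h a), HasDerivWithinAt
            (fun t : ℝ => f (x + H s + t • EuclideanSpace.single a 1) - c a * t)
            (f' a (x + H s + t • EuclideanSpace.single a 1) - c a) (Set.uIcc 0 (h a)) t := by
          intro t _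
          have h1 := hasDerivAt_of_forall_hasLineDerivAt (hf a) (x + H s) t
          have h2 := ((hasDerivAt_id t).const_mul (c a))
          simpa using (h1.fun_sub h2).hasDerivWithinAt
        have hb : ∀ t ∈ Set.uIcc 0 (h a),
            ‖f' a (x + H s + t • EuclideanSpace.single a 1) - c a‖ ≤ B := by
          intro t ht
          rw [Real.norm_eq_abs, add_assoc]
          refine hB a _ (norm_le_norm_of_abs_apply_le fun j => ?_)
          have ht' : |t| ≤ |h a| := by
            rcases Set.mem_uIcc.1 ht with h | h
            · rw [abs_of_nonneg h.1, abs_of_nonneg (h.1.trans h.2)]; exact h.2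
            · rw [abs_of_nonpos h.2, abs_of_nonpos (h.1.trans h.2)]; linarith [h.1]
          by_cases hj : j = a
          · subst hj; simp [hHapply, ha, ht']
          · by_cases hjs : j ∈ s <;> simp [hHapply, hjs, hj]
        have := Convex.norm_image_sub_le_of_norm_hasDerivWithin_le hd hb (convex_uIcc _ _)
          Set.left_mem_uIcc Set.right_mem_uIcc
        simp only [Real.norm_eq_abs, sub_zero, zero_smul, add_zero, mul_zero] at this
        convert this using 2
        ring
      rw [hins, Finset.sum_insert ha, Finset.sum_insert ha, ← add_assoc]
      calc _ = |(f (x + H s + h a • EuclideanSpace.single a 1) - f (x + H s) - c a * h a)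
            + (f (x + H s) - f x - ∑ i ∈ s, c i * h i)| := by congr 1; ring
        _ ≤ _ := (abs_add_le _ _).trans (add_le_add hstep ih)
  have := key Finset.univ
  rw [hHuniv, ← Finset.mul_sum] at this
  exact this.trans (mul_le_mul_of_nonneg_left (sum_abs_le_card_mul_norm h) hB0)

/-- A test function of the `d₄`-distance has Taylor bounds with a constant that depends only on the
dimension: its third partial derivatives exist and are bounded, so the second ones are Lipschitz,
and the mean value inequality along the coordinate directions does the rest. -/
lemma IsTestFunction.hasTaylorBounds {g : EuclideanSpace ℝ ι → ℝ} (hg : IsTestFunction g) :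
    HasTaylorBounds ((1 + (Fintype.card ι : ℝ)) ^ 3) g (fun i => iterPartialDeriv [i] g)
      (fun i j => iterPartialDeriv [j, i] g) := by
  set m : ℝ := (Fintype.card ι : ℝ) with hm
  have hm0 : 0 ≤ m := by positivity
  have k1 : 1 ≤ (1 + m) ^ 3 := by nlinarith [pow_nonneg hm0 3, pow_nonneg hm0 2]
  have k2 : m ≤ (1 + m) ^ 3 := by nlinarith [pow_nonneg hm0 3, pow_nonneg hm0 2]
  have k3 : m * m ≤ (1 + m) ^ 3 := by nlinarith [pow_nonneg hm0 3, pow_nonneg hm0 2]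
  have k4 : m * m * m ≤ (1 + m) ^ 3 := by nlinarith [pow_nonneg hm0 3, pow_nonneg hm0 2]
  have lip : ∀ l : List ι, l.length < 4 → ∀ x h,
      |iterPartialDeriv l g (x + h) - iterPartialDeriv l g x| ≤ m * ‖h‖ := by
    intro l hl x h
    have := abs_increment_sub_linear_le (hg.hasLineDerivAt l hl) x h (fun _ => 0) zero_le_one
      (fun i u _ => by
        simpa using hg.abs_iterPartialDeriv_le (i :: l) (by simp) (by simpa using hl) (x + u))
    simpa using this
  have tay : ∀ l : List ι, l.length < 3 → ∀ x h,
      |iterPartialDeriv l g (x + h) - iterPartialDeriv l g x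
        - ∑ i, iterPartialDeriv (i :: l) g x * h i| ≤ m * m * ‖h‖ ^ 2 := by
    intro l hl x h
    have := abs_increment_sub_linear_le (hg.hasLineDerivAt l (by lia)) x h
      (fun i => iterPartialDeriv (i :: l) g x) (B := m * ‖h‖) (by positivity)
      (fun i u hu => (lip (i :: l) (by simp; lia) x u).trans (by gcongr))
    exact this.trans (le_of_eq (by ring))
  constructor
  · exact fun x h => (lip [] (by simp) x h).trans (by gcongr)
  · exact fun x h => (tay [] (by simp) x h).trans (by gcongr)
  · refine fun x h => (abs_taylor_three_le (tay [] (by simp)) (fun i => tay [i] (by simp))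
      (by positivity) x h).trans ?_
    rw [← mul_assoc]
    gcongr
  · exact fun i x => (hg.abs_iterPartialDeriv_le [i] (by simp) (by simp) x).trans k1
  · exact fun i x h => (lip [i] (by simp) x h).trans (by gcongr)
  · exact fun i x h => (tay [i] (by simp) x h).trans (by gcongr)
  · exact fun i j x => (hg.abs_iterPartialDeriv_le [j, i] (by simp) (by simp) x).trans k1
  · exact fun i j x h => (lip [j, i] (by simp) x h).trans (by gcongr)

end Taylor

/-! ### Sums of locally dependent random vectors -/

section LocalDependence

variable {I : Type*}

lemma dependsOn_finset_sum {κ E : Type*} [AddCommMonoid E] {ξ : κ → (I → Bool) → E}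
    {A : κ → Finset I} (hdep : ∀ k, DependsOn (ξ k) (A k : Set I)) [DecidableEq I] (s : Finset κ) :
    DependsOn (fun ω => ∑ k ∈ s, ξ k ω) (s.biUnion A : Set I) := by
  intro ω ω' h
  refine Finset.sum_congr rfl fun k hk => hdep k fun i hi => h i ?_
  exact Finset.mem_coe.2 (Finset.mem_biUnion.2 ⟨k, hk, hi⟩)

lemma norm_sum_le_card_mul {κ ι : Type*} [Fintype ι] {ξ : κ → (I → Bool) → EuclideanSpace ℝ ι}
    {β : ℝ} (hβ : ∀ k ω, ‖ξ k ω‖ ≤ β) (s : Finset κ) (ω : I → Bool) :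
    ‖∑ k ∈ s, ξ k ω‖ ≤ s.card * β := by
  simpa using (norm_sum_le s (fun k => ξ k ω)).trans
    (Finset.sum_le_card_nsmul s _ β fun k _ => hβ k ω)

/-- The indices `l` for which `ξ l` may depend on `ξ k`, when each `ξ l` is a function of the
coordinates in `A l`. -/
def dependencyNbhd [DecidableEq I] {κ : Type*} [Fintype κ] (A : κ → Finset I) (k : κ) : Finset κ :=
  Finset.univ.filter fun l => ¬ Disjoint (A k) (A l)

lemma disjoint_biUnion_compl [DecidableEq I] {κ : Type*} [Fintype κ] {A : κ → Finset I}
    [DecidableEq κ] {k : κ} {s : Finset κ}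
    (hs : dependencyNbhd A k ⊆ s) : Disjoint (A k) (sᶜ.biUnion A) := by
  rw [Finset.disjoint_biUnion_right]
  intro l hl
  by_contra h
  exact Finset.mem_compl.1 hl (hs (by simp [dependencyNbhd, h]))

variable [Fintype I] {ν : Measure Bool} [IsProbabilityMeasure ν]

lemma integral_mul_of_dependsOn_disjoint {F G : (I → Bool) → ℝ} {S T : Finset I}
    (hF : DependsOn F (S : Set I)) (hG : DependsOn G (T : Set I)) (hST : Disjoint S T) :
    ∫ ω, F ω * G ω ∂(Measure.pi fun _ : I => ν)
      = (∫ ω, F ω ∂(Measure.pi fun _ : I => ν)) * ∫ ω, G ω ∂(Measure.pi fun _ : I => ν) := by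
  obtain ⟨f, rfl⟩ := dependsOn_iff_exists_comp.1 hF
  obtain ⟨g, rfl⟩ := dependsOn_iff_exists_comp.1 hG
  have h := (iIndepFun_pi (μ := fun _ : I => ν) (X := fun _ b => b)
    (fun _ => aemeasurable_id)).indepFun_finset S T hST (fun i => measurable_pi_apply i)
  have h2 := h.comp (φ := f) (ψ := g) (Measurable.of_discrete) (Measurable.of_discrete)
  exact h2.integral_fun_mul_eq_mul_integral Measurable.of_discrete.aestronglyMeasurable
    Measurable.of_discrete.aestronglyMeasurable

lemma abs_integral_mul_le {F G : (I → Bool) → ℝ} {b c : ℝ}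
    (hF : ∀ ω, |F ω| ≤ b) (hG : ∀ ω, |G ω| ≤ c) :
    |∫ ω, F ω * G ω ∂(Measure.pi fun _ : I => ν)| ≤ b * c := by
  have := norm_integral_le_of_norm_le_const (μ := Measure.pi fun _ : I => ν) (C := b * c)
    (f := fun ω => F ω * G ω) (Filter.Eventually.of_forall fun ω => by
      rw [Real.norm_eq_abs, abs_mul]
      exact mul_le_mul (hF ω) (hG ω) (abs_nonneg _) ((abs_nonneg _).trans (hF ω)))
  simpa using this

variable [DecidableEq I] {κ : Type*} [Fintype κ]
variable {ι : Type*} [Fintype ι] {A : κ → Finset I} {ξ : κ → (I → Bool) → EuclideanSpace ℝ ι}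
  {β : ℝ} {D : ℕ}

/-- The random vectors `ξ k` on a product space of signs are centred and bounded by `β`, each `ξ k`
is a function of the coordinates in `A k`, and every `A k` meets at most `D` of the `A l`. -/
structure IsLocallyDependent (ν : Measure Bool) (A : κ → Finset I)
    (ξ : κ → (I → Bool) → EuclideanSpace ℝ ι) (β : ℝ) (D : ℕ) : Prop where
  dependsOn : ∀ k, DependsOn (ξ k) (A k : Set I)
  integral_eq_zero : ∀ k i, ∫ ω, ξ k ω i ∂(Measure.pi fun _ : I => ν) = 0
  norm_le : ∀ k ω, ‖ξ k ω‖ ≤ β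
  card_le : ∀ k, (dependencyNbhd A k).card ≤ D

variable {K : ℝ} {g : EuclideanSpace ℝ ι → ℝ} {g₁ : ι → EuclideanSpace ℝ ι → ℝ}
  {g₂ : ι → ι → EuclideanSpace ℝ ι → ℝ}

/-- Removing the dependency neighbourhood of `k` from the sum makes it independent of `ξ k`, which
is centred; the price is a first order term in the removed part and a quadratic error. -/
lemma IsLocallyDependent.abs_integral_mul_grad_sub_le (hξ : IsLocallyDependent ν A ξ β D)
    (hg : HasTaylorBounds K g g₁ g₂) (hK : 0 ≤ K) (hβ0 : 0 ≤ β) {s : ℝ} (hs0 : 0 ≤ s) (hs1 : s ≤ 1)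
    (k : κ) (i : ι) :
    |(∫ ω, ξ k ω i * g₁ i (s • ∑ l, ξ l ω) ∂(Measure.pi fun _ : I => ν))
      - s * ∑ j, ∑ l ∈ dependencyNbhd A k, ∫ ω, ξ k ω i * ξ l ω j * g₂ i j (s • ∑ l, ξ l ω)
        ∂(Measure.pi fun _ : I => ν)| ≤ β * (K * (D * β) ^ 2) := by
  classical
  set N := dependencyNbhd A k with hN
  set W : (I → Bool) → EuclideanSpace ℝ ι := fun ω => ∑ l, ξ l ω with hW
  set U : (I → Bool) → EuclideanSpace ℝ ι := fun ω => ∑ l ∈ N, ξ l ω with hU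
  have hsplit : ∀ ω, W ω - U ω = ∑ l ∈ Nᶜ, ξ l ω := fun ω => by
    rw [hW, hU, sub_eq_iff_eq_add']
    exact (Finset.sum_add_sum_compl N fun l => ξ l ω).symm
  have hind : ∫ ω, ξ k ω i * g₁ i (s • W ω + -(s • U ω)) ∂(Measure.pi fun _ : I => ν) = 0 := by
    have := integral_mul_of_dependsOn_disjoint (ν := ν) (F := fun ω => ξ k ω i)
      (G := fun ω => g₁ i (s • W ω + -(s • U ω))) (S := A k) (T := Nᶜ.biUnion A)
      (fun ω ω' h => by simp only [hξ.dependsOn k h])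
      (fun ω ω' h => by
        simp only [← sub_eq_add_neg, ← smul_sub, hsplit]
        rw [show ∑ l ∈ Nᶜ, ξ l ω = ∑ l ∈ Nᶜ, ξ l ω' from dependsOn_finset_sum hξ.dependsOn Nᶜ h])
      (disjoint_biUnion_compl subset_rfl)
    rw [this, hξ.integral_eq_zero, zero_mul]
  have hUn : ∀ ω, ‖-(s • U ω)‖ ≤ D * β := fun ω => by
    rw [norm_neg, norm_smul, Real.norm_eq_abs, abs_of_nonneg hs0]
    refine (mul_le_of_le_one_left (norm_nonneg _) hs1).trans ?_
    refine (norm_sum_le_card_mul hξ.norm_le N ω).trans ?_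
    gcongr
    exact hξ.card_le k
  have hlin : ∀ ω, ξ k ω i * (g₁ i (s • W ω + -(s • U ω)) - g₁ i (s • W ω)
        - ∑ j, g₂ i j (s • W ω) * (-(s • U ω)) j)
      = ξ k ω i * g₁ i (s • W ω + -(s • U ω)) - (ξ k ω i * g₁ i (s • W ω)
        - s * ∑ j, ∑ l ∈ N, ξ k ω i * ξ l ω j * g₂ i j (s • W ω)) := by
    intro ω
    have : ∑ j, g₂ i j (s • W ω) * (-(s • U ω)) j
        = - (s * ∑ j, ∑ l ∈ N, ξ l ω j * g₂ i j (s • W ω)) := by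
      rw [Finset.mul_sum, ← Finset.sum_neg_distrib]
      refine Finset.sum_congr rfl fun j _ => ?_
      have : (U ω) j = ∑ l ∈ N, ξ l ω j := by simp [hU]
      rw [← Finset.sum_mul, ← this]
      simp
      ring
    rw [this]
    simp only [mul_assoc, ← Finset.mul_sum]
    ring
  have hb := abs_integral_mul_le (ν := ν)
    (fun ω => (abs_apply_le_norm _ i).trans (hξ.norm_le k ω))
    (fun ω => (hg.grad_taylor_two i (s • W ω) (-(s • U ω))).trans
      (mul_le_mul_of_nonneg_left (pow_le_pow_left₀ (norm_nonneg _) (hUn ω) 2) hK))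
  simp only [hlin] at hb
  rw [integral_sub .of_finite .of_finite, hind, zero_sub, abs_neg,
    integral_sub .of_finite .of_finite, integral_const_mul, integral_finsetSum _
      fun _ _ => .of_finite] at hb
  simp only [integral_finsetSum N fun _ _ => Integrable.of_finite] at hb
  exact hb

/-- Up to a small error, the Hessian evaluated at the sum is uncorrelated with the product of two
summands: remove both dependency neighbourhoods, use independence, and put them back. -/
lemma IsLocallyDependent.abs_integral_mul_hess_sub_le (hξ : IsLocallyDependent ν A ξ β D)
    (hg : HasTaylorBounds K g g₁ g₂) (hK : 0 ≤ K) (hβ0 : 0 ≤ β) {s : ℝ} (hs0 : 0 ≤ s) (hs1 : s ≤ 1)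
    (k l : κ) (i j : ι) :
    |(∫ ω, ξ k ω i * ξ l ω j * g₂ i j (s • ∑ l, ξ l ω) ∂(Measure.pi fun _ : I => ν))
      - (∫ ω, ξ k ω i * ξ l ω j ∂(Measure.pi fun _ : I => ν))
        * ∫ ω, g₂ i j (s • ∑ l, ξ l ω) ∂(Measure.pi fun _ : I => ν)|
      ≤ 2 * (β * β * (K * (2 * D * β))) := by
  classical
  set N := dependencyNbhd A k ∪ dependencyNbhd A l with hN
  set W : (I → Bool) → EuclideanSpace ℝ ι := fun ω => ∑ l, ξ l ω with hW
  set U : (I → Bool) → EuclideanSpace ℝ ι := fun ω => ∑ l ∈ N, ξ l ω with hU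
  have hsplit : ∀ ω, W ω - U ω = ∑ l ∈ Nᶜ, ξ l ω := fun ω => by
    rw [hW, hU, sub_eq_iff_eq_add']
    exact (Finset.sum_add_sum_compl N fun l => ξ l ω).symm
  have hUn : ∀ ω, ‖-(s • U ω)‖ ≤ 2 * D * β := fun ω => by
    rw [norm_neg, norm_smul, Real.norm_eq_abs, abs_of_nonneg hs0]
    refine (mul_le_of_le_one_left (norm_nonneg _) hs1).trans ?_
    refine (norm_sum_le_card_mul hξ.norm_le N ω).trans ?_
    gcongr
    have := (Finset.card_union_le (dependencyNbhd A k) (dependencyNbhd A l)).trans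
      (add_le_add (hξ.card_le k) (hξ.card_le l))
    rw [← two_mul] at this
    exact_mod_cast this
  have hind := integral_mul_of_dependsOn_disjoint (ν := ν) (F := fun ω => ξ k ω i * ξ l ω j)
      (G := fun ω => g₂ i j (s • W ω + -(s • U ω))) (S := A k ∪ A l) (T := Nᶜ.biUnion A)
      (fun ω ω' h => by
        simp only [hξ.dependsOn k fun a ha => h a (by simp; exact .inl ha),
          hξ.dependsOn l fun a ha => h a (by simp; exact .inr ha)])
      (fun ω ω' h => by
        simp only [← sub_eq_add_neg, ← smul_sub, hsplit]
        rw [show ∑ l ∈ Nᶜ, ξ l ω = ∑ l ∈ Nᶜ, ξ l ω' from dependsOn_finset_sum hξ.dependsOn Nᶜ h])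
      (Finset.disjoint_union_left.2 ⟨disjoint_biUnion_compl Finset.subset_union_left,
        disjoint_biUnion_compl Finset.subset_union_right⟩)
  have hprod : ∀ ω, |ξ k ω i * ξ l ω j| ≤ β * β := fun ω => by
    rw [abs_mul]
    exact mul_le_mul ((abs_apply_le_norm _ i).trans (hξ.norm_le k ω))
      ((abs_apply_le_norm _ j).trans (hξ.norm_le l ω)) (abs_nonneg _) hβ0
  have hdiff : ∀ ω, |g₂ i j (s • W ω + -(s • U ω)) - g₂ i j (s • W ω)| ≤ K * (2 * D * β) :=
    fun ω => (hg.abs_hess_sub_le i j _ _).trans (mul_le_mul_of_nonneg_left (hUn ω) hK)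
  have h1 := abs_integral_mul_le (ν := ν) hprod hdiff
  have h2 := abs_integral_mul_le (ν := ν) hprod (G := fun _ => 1) (c := 1) (by simp)
  have h3 := abs_integral_mul_le (ν := ν) (F := fun _ => 1) (b := 1) (by simp) hdiff
  simp only [mul_one, one_mul] at h2 h3
  simp only [mul_sub] at h1
  rw [integral_sub .of_finite .of_finite, hind] at h1
  rw [integral_sub .of_finite .of_finite] at h3
  set P := ∫ ω, ξ k ω i * ξ l ω j ∂(Measure.pi fun _ : I => ν)
  set Q := ∫ ω, g₂ i j (s • W ω + -(s • U ω)) ∂(Measure.pi fun _ : I => ν)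
  set R := ∫ ω, g₂ i j (s • W ω) ∂(Measure.pi fun _ : I => ν)
  set T := ∫ ω, ξ k ω i * ξ l ω j * g₂ i j (s • W ω) ∂(Measure.pi fun _ : I => ν)
  have h4 : |P * (Q - R)| ≤ β * β * (K * (2 * D * β)) := by
    rw [abs_mul]
    exact mul_le_mul h2 h3 (abs_nonneg _) (by positivity)
  calc |T - P * R| = |P * (Q - R) - (P * Q - T)| := by congr 1; ring
    _ ≤ |P * (Q - R)| + |P * Q - T| := abs_sub _ _
    _ ≤ _ := by linarith

lemma IsLocallyDependent.integral_mul_eq_zero (hξ : IsLocallyDependent ν A ξ β D) {k l : κ}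
    (hl : l ∉ dependencyNbhd A k) (i j : ι) :
    ∫ ω, ξ k ω i * ξ l ω j ∂(Measure.pi fun _ : I => ν) = 0 := by
  have := integral_mul_of_dependsOn_disjoint (ν := ν) (F := fun ω => ξ k ω i)
    (G := fun ω => ξ l ω j) (S := A k) (T := A l)
    (fun ω ω' h => by simp only [hξ.dependsOn k h]) (fun ω ω' h => by simp only [hξ.dependsOn l h])
    (by simpa [dependencyNbhd] using hl)
  rw [this, hξ.integral_eq_zero, zero_mul]

lemma IsLocallyDependent.integral_sum_mul_sum (hξ : IsLocallyDependent ν A ξ β D) (i j : ι) :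
    ∫ ω, (∑ k, ξ k ω) i * (∑ k, ξ k ω) j ∂(Measure.pi fun _ : I => ν)
      = ∑ k, ∑ l ∈ dependencyNbhd A k, ∫ ω, ξ k ω i * ξ l ω j ∂(Measure.pi fun _ : I => ν) := by
  have : ∀ ω, (∑ k, ξ k ω) i * (∑ k, ξ k ω) j = ∑ k, ∑ l, ξ k ω i * ξ l ω j := fun ω => by
    simp [Finset.sum_mul_sum]
  simp only [this]
  rw [integral_finsetSum _ fun _ _ => .of_finite]
  refine Finset.sum_congr rfl fun k _ => ?_
  rw [integral_finsetSum _ fun _ _ => .of_finite]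
  exact (Finset.sum_subset (Finset.subset_univ _)
    fun l _ hl => hξ.integral_mul_eq_zero hl i j).symm

/-- Approximate integration by parts for a sum `W` of locally dependent vectors:
`𝔼 ⟨W, ∇g(sW)⟩ ≈ s ∑ Cov(Wᵢ, Wⱼ) 𝔼 ∂ᵢ∂ⱼg(sW)`, with an error of third order in the summands. -/
theorem IsLocallyDependent.abs_integral_inner_grad_sub_le (hξ : IsLocallyDependent ν A ξ β D)
    (hg : HasTaylorBounds K g g₁ g₂) (hK : 0 ≤ K) (hβ0 : 0 ≤ β)
    {s : ℝ} (hs0 : 0 ≤ s) (hs1 : s ≤ 1) :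
    |(∫ ω, ∑ i, (∑ k, ξ k ω) i * g₁ i (s • ∑ k, ξ k ω) ∂(Measure.pi fun _ : I => ν))
      - s * ∑ i, ∑ j, (∫ ω, (∑ k, ξ k ω) i * (∑ k, ξ k ω) j ∂(Measure.pi fun _ : I => ν))
        * ∫ ω, g₂ i j (s • ∑ k, ξ k ω) ∂(Measure.pi fun _ : I => ν)|
      ≤ Fintype.card κ * β ^ 3 * (K * D ^ 2 * (5 * (1 + Fintype.card ι) ^ 2)) := by
  set m : ℝ := (Fintype.card ι : ℝ) with hm
  set a : κ → ι → ℝ := fun k i =>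
    ∫ ω, ξ k ω i * g₁ i (s • ∑ l, ξ l ω) ∂(Measure.pi fun _ : I => ν) with ha
  set b : κ → ι → ι → κ → ℝ := fun k i j l =>
    ∫ ω, ξ k ω i * ξ l ω j * g₂ i j (s • ∑ l, ξ l ω) ∂(Measure.pi fun _ : I => ν) with hb
  set c : κ → ι → ι → κ → ℝ := fun k i j l =>
    (∫ ω, ξ k ω i * ξ l ω j ∂(Measure.pi fun _ : I => ν))
      * ∫ ω, g₂ i j (s • ∑ l, ξ l ω) ∂(Measure.pi fun _ : I => ν) with hc
  have e1 : (∫ ω, ∑ i, (∑ k, ξ k ω) i * g₁ i (s • ∑ k, ξ k ω) ∂(Measure.pi fun _ : I => ν))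
      = ∑ i, ∑ k, a k i := by
    rw [integral_finsetSum _ fun _ _ => .of_finite]
    refine Finset.sum_congr rfl fun i _ => ?_
    rw [ha, ← integral_finsetSum _ fun _ _ => .of_finite]
    simp [Finset.sum_mul]
  have e2 : ∀ i j, (∫ ω, (∑ k, ξ k ω) i * (∑ k, ξ k ω) j ∂(Measure.pi fun _ : I => ν))
        * ∫ ω, g₂ i j (s • ∑ k, ξ k ω) ∂(Measure.pi fun _ : I => ν)
      = ∑ k, ∑ l ∈ dependencyNbhd A k, c k i j l := fun i j => by
    rw [hξ.integral_sum_mul_sum, Finset.sum_mul]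
    exact Finset.sum_congr rfl fun k _ => Finset.sum_mul _ _ _
  have e3 : ∑ i, ∑ k, a k i - s * ∑ i, ∑ j, ∑ k, ∑ l ∈ dependencyNbhd A k, c k i j l
      = ∑ i, ∑ k, ((a k i - s * ∑ j, ∑ l ∈ dependencyNbhd A k, b k i j l)
        + s * ∑ j, ∑ l ∈ dependencyNbhd A k, (b k i j l - c k i j l)) := by
    rw [Finset.mul_sum, ← Finset.sum_sub_distrib]
    refine Finset.sum_congr rfl fun i _ => ?_
    rw [Finset.sum_comm, Finset.mul_sum, ← Finset.sum_sub_distrib]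
    refine Finset.sum_congr rfl fun k _ => ?_
    simp only [Finset.sum_sub_distrib]
    ring
  have hbc : ∀ k i, |∑ j, ∑ l ∈ dependencyNbhd A k, (b k i j l - c k i j l)|
      ≤ m * (D * (2 * (β * β * (K * (2 * D * β))))) := by
    intro k i
    refine (Finset.abs_sum_le_sum_abs _ _).trans ?_
    refine (Finset.sum_le_card_nsmul _ _ (D * (2 * (β * β * (K * (2 * D * β)))))
      fun j _ => ?_).trans (by simp [hm])
    refine (Finset.abs_sum_le_sum_abs _ _).trans ?_
    refine (Finset.sum_le_card_nsmul _ _ _ fun l _ =>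
      hξ.abs_integral_mul_hess_sub_le hg hK hβ0 hs0 hs1 k l i j).trans ?_
    rw [nsmul_eq_mul]
    gcongr
    exact hξ.card_le k
  have hterm : ∀ i k, |(a k i - s * ∑ j, ∑ l ∈ dependencyNbhd A k, b k i j l)
        + s * ∑ j, ∑ l ∈ dependencyNbhd A k, (b k i j l - c k i j l)|
      ≤ β ^ 3 * (K * D ^ 2 * (1 + 4 * m)) := by
    intro i k
    refine (abs_add_le _ _).trans ?_
    have h1 := hξ.abs_integral_mul_grad_sub_le hg hK hβ0 hs0 hs1 k i
    have h2 := mul_le_mul hs1 (hbc k i) (abs_nonneg _) zero_le_one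
    rw [abs_mul, abs_of_nonneg hs0]
    refine (add_le_add h1 h2).trans (le_of_eq ?_)
    ring
  rw [e1]
  simp only [e2]
  rw [e3]
  refine (Finset.abs_sum_le_sum_abs _ _).trans ?_
  refine (Finset.sum_le_card_nsmul _ _ (Fintype.card κ * (β ^ 3 * (K * D ^ 2 * (1 + 4 * m))))
    fun i _ => ?_).trans ?_
  · refine (Finset.abs_sum_le_sum_abs _ _).trans ?_
    refine (Finset.sum_le_card_nsmul _ _ _ fun k _ => hterm i k).trans (by simp)
  · rw [nsmul_eq_mul, Finset.card_univ, ← hm]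
    have hm0 : 0 ≤ m := by positivity
    have : m * (1 + 4 * m) ≤ 5 * (1 + m) ^ 2 := by nlinarith
    calc m * (Fintype.card κ * (β ^ 3 * (K * D ^ 2 * (1 + 4 * m))))
        = Fintype.card κ * β ^ 3 * (K * D ^ 2 * (m * (1 + 4 * m))) := by ring
      _ ≤ _ := by gcongr

end LocalDependence

/-! ### Gaussian vectors -/

section Gaussian

variable {ι : Type*} [Fintype ι] [DecidableEq ι] {S : Matrix ι ι ℝ}

lemma integrable_norm_pow_multivariateGaussian (S : Matrix ι ι ℝ) (k : ℕ) :
    Integrable (fun y => ‖y‖ ^ k) (multivariateGaussian 0 S) := by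
  have h := (IsGaussian.memLp_id (multivariateGaussian 0 S) k (by simp)).integrable_norm_pow'
  simpa using h

lemma integral_apply_multivariateGaussian (S : Matrix ι ι ℝ) (i : ι) :
    ∫ y, y i ∂(multivariateGaussian 0 S) = 0 := by
  have h := (EuclideanSpace.proj i : EuclideanSpace ℝ ι →L[ℝ] ℝ).integral_comp_id_comm
    (μ := multivariateGaussian 0 S) IsGaussian.integrable_id
  simpa using h

lemma integrable_apply_multivariateGaussian (S : Matrix ι ι ℝ) (i : ι) :
    Integrable (fun y => y i) (multivariateGaussian 0 S) :=
  (EuclideanSpace.proj i : EuclideanSpace ℝ ι →L[ℝ] ℝ).integrable_comp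
    (IsGaussian.integrable_id (μ := multivariateGaussian 0 S))

lemma memLp_two_apply_multivariateGaussian (S : Matrix ι ι ℝ) (i : ι) :
    MemLp (fun y => y i) 2 (multivariateGaussian 0 S) :=
  (EuclideanSpace.proj i : EuclideanSpace ℝ ι →L[ℝ] ℝ).comp_memLp'
    (IsGaussian.memLp_two_id (μ := multivariateGaussian 0 S))

lemma integrable_apply_mul_apply_multivariateGaussian (S : Matrix ι ι ℝ) (i j : ι) :
    Integrable (fun y => y i * y j) (multivariateGaussian 0 S) :=
  (memLp_two_apply_multivariateGaussian S i).integrable_mul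
    (memLp_two_apply_multivariateGaussian S j)

lemma integral_apply_mul_apply_multivariateGaussian (hS : S.PosSemidef) (i j : ι) :
    ∫ y, y i * y j ∂(multivariateGaussian 0 S) = S i j := by
  rw [← covariance_eval_multivariateGaussian (μ := 0) hS i j, covariance_eq_sub
    (memLp_two_apply_multivariateGaussian S i) (memLp_two_apply_multivariateGaussian S j)]
  simp [integral_apply_multivariateGaussian]

/-- A centred Gaussian vector scaled by `c` has the law of the sum of two independent copies scaled
by `a` and `b`, where `a² + b² = c²`; this is the rotation invariance of `μ ⊗ μ`. -/
lemma integral_comp_smul_multivariateGaussian {f : EuclideanSpace ℝ ι → ℝ} (hf : Continuous f)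
    {a b c : ℝ} (ha : 0 ≤ a) (hc : 0 ≤ c) (habc : a ^ 2 + b ^ 2 = c ^ 2)
    (hint : Integrable (fun y => f (c • y)) (multivariateGaussian 0 S)) :
    ∫ y, f (c • y) ∂(multivariateGaussian 0 S)
      = ∫ y', ∫ y, f (a • y + b • y') ∂(multivariateGaussian 0 S) ∂(multivariateGaussian 0 S) := by
  set γ := multivariateGaussian (0 : EuclideanSpace ℝ ι) S
  rcases hc.eq_or_lt with rfl | hc
  · have ha : a = 0 := by nlinarith [sq_nonneg a, sq_nonneg b]
    have hb : b = 0 := by nlinarith [sq_nonneg a, sq_nonneg b]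
    simp [ha, hb]
  obtain ⟨θ, hcos, hsin⟩ : ∃ θ : ℝ, c * Real.cos θ = b ∧ c * Real.sin θ = a := by
    refine ⟨Real.arccos (b / c), ?_, ?_⟩
    · rw [Real.cos_arccos]
      · field_simp
      · rw [le_div_iff₀ hc]; nlinarith [sq_nonneg a]
      · rw [div_le_one hc]; nlinarith [sq_nonneg a]
    · have h1 : 1 - (b / c) ^ 2 = (a / c) ^ 2 := by
        field_simp
        linarith
      rw [Real.sin_arccos, h1, Real.sqrt_sq (by positivity)]
      field_simp
  have hmap : (γ.prod γ).map (fun p => Real.cos θ • p.1 + Real.sin θ • p.2) = γ := by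
    have h := congrArg (Measure.map Prod.fst) (IsGaussian.map_rotation_eq_self (μ := γ)
      (integral_id_multivariateGaussian') θ)
    rw [Measure.map_map measurable_fst (by fun_prop), Measure.map_fst_prod] at h
    rw [measure_univ, one_smul] at h
    exact h
  have hcomp : ∀ p : EuclideanSpace ℝ ι × EuclideanSpace ℝ ι,
      c • (Real.cos θ • p.1 + Real.sin θ • p.2) = a • p.2 + b • p.1 := fun p => by
    rw [smul_add, smul_smul, smul_smul, hcos, hsin, add_comm]
  have hfc : Continuous fun y => f (c • y) := by fun_prop
  have h1 := integral_map (μ := γ.prod γ) (φ := fun p => Real.cos θ • p.1 + Real.sin θ • p.2)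
    (f := fun y => f (c • y)) (by fun_prop) hfc.aestronglyMeasurable
  have h2 := integrable_map_measure (μ := γ.prod γ)
    (f := fun p => Real.cos θ • p.1 + Real.sin θ • p.2)
    (g := fun y => f (c • y)) hfc.aestronglyMeasurable (by fun_prop)
  rw [hmap] at h1 h2
  have h3 := h2.1 hint
  simp only [Function.comp_def, hcomp] at h1 h3
  rw [h1, integral_prod _ h3]

end Gaussian

/-! ### Averages over translates -/

section Averaging

variable {ι : Type*} [Fintype ι] {K : ℝ} {g : EuclideanSpace ℝ ι → ℝ}
  {g₁ : ι → EuclideanSpace ℝ ι → ℝ} {g₂ : ι → ι → EuclideanSpace ℝ ι → ℝ}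

lemma continuous_of_abs_add_sub_le {E : Type*} [NormedAddCommGroup E] {f : E → ℝ} {K : ℝ}
    (hf : ∀ x h, |f (x + h) - f x| ≤ K * ‖h‖) : Continuous f := by
  refine (LipschitzWith.of_dist_le' (K := K) fun x y => ?_).continuous
  have := hf y (x - y)
  rwa [add_sub_cancel, ← Real.dist_eq, ← dist_eq_norm] at this

lemma HasTaylorBounds.continuous (hg : HasTaylorBounds K g g₁ g₂) : Continuous g :=
  continuous_of_abs_add_sub_le hg.abs_sub_le

lemma HasTaylorBounds.continuous_grad (hg : HasTaylorBounds K g g₁ g₂) (i : ι) :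
    Continuous (g₁ i) :=
  continuous_of_abs_add_sub_le (hg.abs_grad_sub_le i)

lemma HasTaylorBounds.continuous_hess (hg : HasTaylorBounds K g g₁ g₂) (i j : ι) :
    Continuous (g₂ i j) :=
  continuous_of_abs_add_sub_le (hg.abs_hess_sub_le i j)

variable {γ : Measure (EuclideanSpace ℝ ι)} [IsProbabilityMeasure γ]

lemma HasTaylorBounds.integrable_comp (hg : HasTaylorBounds K g g₁ g₂)
    (hγ : Integrable (fun y => ‖y‖) γ) (a : ℝ) (x : EuclideanSpace ℝ ι) :
    Integrable (fun y => g (x + a • y)) γ := by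
  have hcont : Continuous fun y => g (x + a • y) := hg.continuous.comp (by fun_prop)
  refine Integrable.mono' (((hγ.const_mul |a|).const_mul K).add (integrable_const |g x|))
    hcont.aestronglyMeasurable (Filter.Eventually.of_forall fun y => ?_)
  have := hg.abs_sub_le x (a • y)
  rw [norm_smul, Real.norm_eq_abs] at this
  rw [Real.norm_eq_abs]
  calc |g (x + a • y)| = |(g (x + a • y) - g x) + g x| := by congr 1; ring
    _ ≤ _ := (abs_add_le _ _).trans (add_le_add_left this _)

lemma HasTaylorBounds.integrable_grad_comp (hg : HasTaylorBounds K g g₁ g₂) (i : ι) (a : ℝ)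
    (x : EuclideanSpace ℝ ι) : Integrable (fun y => g₁ i (x + a • y)) γ :=
  Integrable.of_bound ((hg.continuous_grad i).comp (by fun_prop)).aestronglyMeasurable K
    (Filter.Eventually.of_forall fun _ => hg.abs_grad_le i _)

lemma HasTaylorBounds.integrable_hess_comp (hg : HasTaylorBounds K g g₁ g₂) (i j : ι) (a : ℝ)
    (x : EuclideanSpace ℝ ι) : Integrable (fun y => g₂ i j (x + a • y)) γ :=
  Integrable.of_bound ((hg.continuous_hess i j).comp (by fun_prop)).aestronglyMeasurable K
    (Filter.Eventually.of_forall fun _ => hg.abs_hess_le i j _)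

lemma abs_integral_le_of_forall_abs_le {E : Type*} [MeasurableSpace E] {γ : Measure E}
    [IsProbabilityMeasure γ] {f : E → ℝ} {C : ℝ} (h : ∀ y, |f y| ≤ C) : |∫ y, f y ∂γ| ≤ C := by
  simpa using norm_integral_le_of_norm_le_const (μ := γ) (f := f) (C := C)
    (Filter.Eventually.of_forall h)

/-- Taylor bounds survive averaging over translates. -/
lemma HasTaylorBounds.average (hg : HasTaylorBounds K g g₁ g₂)
    (hγ : Integrable (fun y => ‖y‖) γ) (a : ℝ) :
    HasTaylorBounds K (fun x => ∫ y, g (x + a • y) ∂γ) (fun i x => ∫ y, g₁ i (x + a • y) ∂γ)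
      (fun i j x => ∫ y, g₂ i j (x + a • y) ∂γ) := by
  have i0 := fun x => hg.integrable_comp hγ a x
  have i1 := fun i x => hg.integrable_grad_comp (γ := γ) i a x
  have i2 := fun i j x => hg.integrable_hess_comp (γ := γ) i j a x
  have s1 : ∀ x (h : EuclideanSpace ℝ ι), ∑ i, (∫ y, g₁ i (x + a • y) ∂γ) * h i
      = ∫ y, ∑ i, g₁ i (x + a • y) * h i ∂γ := fun x h => by
    rw [integral_finsetSum _ fun i _ => (i1 i x).mul_const _]
    simp only [integral_mul_const]
  have s2 : ∀ i x (h : EuclideanSpace ℝ ι), ∑ j, (∫ y, g₂ i j (x + a • y) ∂γ) * h j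
      = ∫ y, ∑ j, g₂ i j (x + a • y) * h j ∂γ := fun i x h => by
    rw [integral_finsetSum _ fun j _ => (i2 i j x).mul_const _]
    simp only [integral_mul_const]
  have j1 : ∀ x (h : EuclideanSpace ℝ ι), Integrable (fun y => ∑ i, g₁ i (x + a • y) * h i) γ :=
    fun x h => integrable_finsetSum _ fun i _ => (i1 i x).mul_const _
  have j2 : ∀ x (h : EuclideanSpace ℝ ι),
      Integrable (fun y => ∑ i, ∑ j, g₂ i j (x + a • y) * (h i * h j)) γ :=
    fun x h => integrable_finsetSum _ fun i _ => integrable_finsetSum _ fun j _ =>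
      (i2 i j x).mul_const _
  have s3 : ∀ x (h : EuclideanSpace ℝ ι),
      ∑ i, ∑ j, (∫ y, g₂ i j (x + a • y) ∂γ) * (h i * h j)
      = ∫ y, ∑ i, ∑ j, g₂ i j (x + a • y) * (h i * h j) ∂γ := fun x h => by
    rw [integral_finsetSum _ fun i _ => integrable_finsetSum _ fun j _ => (i2 i j x).mul_const _]
    refine Finset.sum_congr rfl fun i _ => ?_
    rw [integral_finsetSum _ fun j _ => (i2 i j x).mul_const _]
    simp only [integral_mul_const]
  refine ⟨fun x h => ?_, fun x h => ?_, fun x h => ?_, fun i x => ?_, fun i x h => ?_,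
    fun i x h => ?_, fun i j x => ?_, fun i j x h => ?_⟩
  · rw [← integral_sub (i0 _) (i0 _)]
    refine abs_integral_le_of_forall_abs_le fun y => ?_
    rw [add_right_comm]
    exact hg.abs_sub_le _ _
  · rw [s1, ← integral_sub (i0 _) (i0 _), ← integral_sub ((i0 _).sub' (i0 _)) (j1 _ _)]
    refine abs_integral_le_of_forall_abs_le fun y => ?_
    rw [add_right_comm]
    exact hg.taylor_two _ _
  · rw [s1, s3, ← integral_sub (i0 _) (i0 _), ← integral_sub ((i0 _).sub' (i0 _)) (j1 _ _),
      ← integral_div, ← integral_sub (((i0 _).sub' (i0 _)).sub' (j1 _ _)) ((j2 _ _).div_const _)]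
    refine abs_integral_le_of_forall_abs_le fun y => ?_
    rw [add_right_comm]
    exact hg.taylor_three _ _
  · exact abs_integral_le_of_forall_abs_le fun y => hg.abs_grad_le i _
  · rw [← integral_sub (i1 _ _) (i1 _ _)]
    refine abs_integral_le_of_forall_abs_le fun y => ?_
    rw [add_right_comm]
    exact hg.abs_grad_sub_le i _ _
  · rw [s2, ← integral_sub (i1 _ _) (i1 _ _),
      ← integral_sub ((i1 _ _).sub' (i1 _ _)) (integrable_finsetSum _ fun j _ =>
        (i2 i j x).mul_const _)]
    refine abs_integral_le_of_forall_abs_le fun y => ?_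
    rw [add_right_comm]
    exact hg.grad_taylor_two i _ _
  · exact abs_integral_le_of_forall_abs_le fun y => hg.abs_hess_le i j _
  · rw [← integral_sub (i2 _ _ _) (i2 _ _ _)]
    refine abs_integral_le_of_forall_abs_le fun y => ?_
    rw [add_right_comm]
    exact hg.abs_hess_sub_le i j _ _

end Averaging

/-! ### Interpolation between a random vector and a Gaussian vector -/

section SmartPath

variable {ι : Type*} [Fintype ι] [DecidableEq ι] {S : Matrix ι ι ℝ} {K : ℝ}
  {g : EuclideanSpace ℝ ι → ℝ} {g₁ : ι → EuclideanSpace ℝ ι → ℝ}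
  {g₂ : ι → ι → EuclideanSpace ℝ ι → ℝ}

/-- The generator of the heat flow: a small Gaussian perturbation `b • y` changes the mean of `g` by
`b² / 2` times the `S`-Laplacian, up to `b³`. -/
lemma HasTaylorBounds.abs_integral_gaussian_sub_le (hg : HasTaylorBounds K g g₁ g₂)
    (hS : S.PosSemidef) {b : ℝ} (hb : 0 ≤ b) (x : EuclideanSpace ℝ ι) :
    |(∫ y, g (x + b • y) ∂(multivariateGaussian 0 S)) - g x
      - b ^ 2 * (∑ i, ∑ j, S i j * g₂ i j x) / 2|
      ≤ K * b ^ 3 * ∫ y, ‖y‖ ^ 3 ∂(multivariateGaussian 0 S) := by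
  set γ := multivariateGaussian (0 : EuclideanSpace ℝ ι) S with hγ
  have i0 : Integrable (fun y => g (x + b • y)) γ :=
    hg.integrable_comp (by simpa using integrable_norm_pow_multivariateGaussian S 1) b x
  have i1 : ∀ i, Integrable (fun y : EuclideanSpace ℝ ι => g₁ i x * (b • y) i) γ := fun i => by
    simpa using ((integrable_apply_multivariateGaussian S i).const_mul b).const_mul (g₁ i x)
  have e2 : ∀ i j (y : EuclideanSpace ℝ ι), g₂ i j x * ((b • y) i * (b • y) j)
      = b ^ 2 * g₂ i j x * (y i * y j) := fun i j y => by
    simp; ring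
  have i2 : ∀ i j, Integrable
      (fun y : EuclideanSpace ℝ ι => g₂ i j x * ((b • y) i * (b • y) j)) γ := fun i j => by
    simp only [e2]
    exact (integrable_apply_mul_apply_multivariateGaussian S i j).const_mul _
  have s1 : ∫ y, ∑ i, g₁ i x * (b • y) i ∂γ = 0 := by
    rw [integral_finsetSum _ fun i _ => i1 i]
    refine Finset.sum_eq_zero fun i _ => ?_
    simp [integral_const_mul, hγ, integral_apply_multivariateGaussian]
  have s2 : ∫ y, ∑ i, ∑ j, g₂ i j x * ((b • y) i * (b • y) j) ∂γ
      = b ^ 2 * ∑ i, ∑ j, S i j * g₂ i j x := by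
    rw [integral_finsetSum _ fun i _ => integrable_finsetSum _ fun j _ => i2 i j, Finset.mul_sum]
    refine Finset.sum_congr rfl fun i _ => ?_
    rw [integral_finsetSum _ fun j _ => i2 i j, Finset.mul_sum]
    refine Finset.sum_congr rfl fun j _ => ?_
    simp only [e2]
    rw [integral_const_mul, integral_apply_mul_apply_multivariateGaussian hS]
    ring
  have j1 := integrable_finsetSum Finset.univ fun i _ => i1 i
  have j2 := integrable_finsetSum Finset.univ fun i _ =>
    integrable_finsetSum Finset.univ fun j _ => i2 i j
  have hbound := norm_integral_le_of_norm_le (μ := γ)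
    (f := fun y => g (x + b • y) - g x - ∑ i, g₁ i x * (b • y) i
      - (∑ i, ∑ j, g₂ i j x * ((b • y) i * (b • y) j)) / 2)
    (g := fun y => K * b ^ 3 * ‖y‖ ^ 3)
    ((integrable_norm_pow_multivariateGaussian S 3).const_mul _)
    (Filter.Eventually.of_forall fun y => by
      have := hg.taylor_three x (b • y)
      rwa [norm_smul, mul_pow, ← mul_assoc, Real.norm_eq_abs, abs_of_nonneg hb] at this)
  rw [integral_sub ((i0.sub' (integrable_const _)).sub' j1) (j2.div_const _),
    integral_sub (i0.sub' (integrable_const _)) j1, integral_sub i0 (integrable_const _),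
    integral_div, s1, s2, integral_const_mul] at hbound
  simpa using hbound

variable {Ω : Type*} [Finite Ω] [MeasurableSpace Ω] [MeasurableSingletonClass Ω] {P : Measure Ω}
  [IsProbabilityMeasure P] {W : Ω → EuclideanSpace ℝ ι} {ε : ℝ}

/-- `W` satisfies the Gaussian integration by parts formula with covariance matrix `S` up to an
error `ε`, for all functions with Taylor bounds and along the whole segment `s • W`. -/
def ApproxIntegrationByParts (P : Measure Ω) (W : Ω → EuclideanSpace ℝ ι) (S : Matrix ι ι ℝ)
    (K ε : ℝ) : Prop :=
  ∀ (g : EuclideanSpace ℝ ι → ℝ) (g₁ : ι → EuclideanSpace ℝ ι → ℝ)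
    (g₂ : ι → ι → EuclideanSpace ℝ ι → ℝ), HasTaylorBounds K g g₁ g₂ →
    ∀ s : ℝ, 0 ≤ s → s ≤ 1 →
      |(∫ ω, ∑ i, W ω i * g₁ i (s • W ω) ∂P)
        - s * ∑ i, ∑ j, S i j * ∫ ω, g₂ i j (s • W ω) ∂P| ≤ ε

/-- The interpolation `s ↦ 𝔼 g (s W + √(1 - s²) N)` between the law of a Gaussian vector `N` at
`s = 0` and that of `W` at `s = 1`. -/
def smartPath (P : Measure Ω) (W : Ω → EuclideanSpace ℝ ι) (S : Matrix ι ι ℝ)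
    (g : EuclideanSpace ℝ ι → ℝ) (s : ℝ) : ℝ :=
  ∫ ω, ∫ y, g (s • W ω + √(1 - s ^ 2) • y) ∂(multivariateGaussian 0 S) ∂P

/-- One step of the interpolation. Lowering the Gaussian weight from `1 - s²` to `1 - t²` removes an
independent Gaussian part of variance `t² - s²`, whose effect is of first order in `t - s` and
cancels the first order effect of enlarging the weight of `W` up to `ε`. -/
lemma abs_smartPath_sub_le (hW : ApproxIntegrationByParts P W S K ε) (hS : S.PosSemidef)
    (hg : HasTaylorBounds K g g₁ g₂) (hK : 0 ≤ K) {s t : ℝ} (hs : 0 ≤ s) (hst : s ≤ t)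
    (ht : t ≤ 1) :
    |smartPath P W S g t - smartPath P W S g s| ≤ (t - s) * (ε
      + (t - s) * (K * (∫ ω, ‖W ω‖ ^ 2 ∂P) + ∑ i, ∑ j, |S i j| * K)
      + √(2 * (t - s)) * (2 * K * ∫ y, ‖y‖ ^ 3 ∂(multivariateGaussian 0 S))) := by
  set γ := multivariateGaussian (0 : EuclideanSpace ℝ ι) S with hγ
  have hγ1 : Integrable (fun y => ‖y‖) γ := by
    simpa using integrable_norm_pow_multivariateGaussian S 1
  set δ := t - s with hδ
  have hδ0 : 0 ≤ δ := sub_nonneg.2 hst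
  set a := √(1 - t ^ 2) with ha
  set b := √(t ^ 2 - s ^ 2) with hb
  have hb2 : b ^ 2 = δ * (2 * s + δ) := by
    rw [hb, Real.sq_sqrt (by nlinarith)]; ring
  have ha2 : a ^ 2 = 1 - t ^ 2 := Real.sq_sqrt (by nlinarith)
  have hbδ : b ≤ √(2 * δ) := Real.sqrt_le_sqrt (by nlinarith)
  have hb0 : 0 ≤ b := Real.sqrt_nonneg _
  set G := fun x => ∫ y, g (x + a • y) ∂γ with hG
  set G₁ := fun i x => ∫ y, g₁ i (x + a • y) ∂γ with hG₁
  set G₂ := fun i j x => ∫ y, g₂ i j (x + a • y) ∂γ with hG₂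
  have hGt : HasTaylorBounds K G G₁ G₂ := hg.average hγ1 a
  have et : smartPath P W S g t = ∫ ω, G (t • W ω) ∂P := rfl
  have es : smartPath P W S g s = ∫ ω, ∫ y, G (s • W ω + b • y) ∂γ ∂P := by
    refine integral_congr_ae (Filter.Eventually.of_forall fun ω => ?_)
    have := integral_comp_smul_multivariateGaussian (S := S) (f := fun y => g (s • W ω + y))
      (a := a) (b := b) (c := √(1 - s ^ 2)) (hg.continuous.comp (by fun_prop))
      (Real.sqrt_nonneg _) (Real.sqrt_nonneg _)
      (by rw [ha2, hb, Real.sq_sqrt (by nlinarith), Real.sq_sqrt (by nlinarith)]; ring)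
      (hg.integrable_comp hγ1 _ _)
    refine this.trans ?_
    simp only [hG, add_assoc, add_comm (a • _)]
    rfl
  set m₃ := ∫ y, ‖y‖ ^ 3 ∂γ with hm₃
  have hm₃0 : 0 ≤ m₃ := integral_nonneg fun y => by positivity
  set M₂ := ∫ ω, ‖W ω‖ ^ 2 ∂P with hM₂
  set L : Ω → ℝ := fun ω => ∑ i, W ω i * G₁ i (s • W ω) with hL
  set Q : Ω → ℝ := fun ω => ∑ i, ∑ j, S i j * G₂ i j (s • W ω) with hQ
  -- pointwise expansions of both expectations around `s • W ω`
  have hA : ∀ ω, |G (t • W ω) - G (s • W ω) - δ * L ω| ≤ K * δ ^ 2 * ‖W ω‖ ^ 2 := by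
    intro ω
    have h := hGt.taylor_two (s • W ω) (δ • W ω)
    rw [← add_smul, hδ, add_sub_cancel, ← hδ, norm_smul, mul_pow, Real.norm_eq_abs, sq_abs,
      ← mul_assoc] at h
    refine le_of_eq_of_le ?_ h
    rw [hL, Finset.mul_sum]
    congr 2
    exact Finset.sum_congr rfl fun i _ => by simp; ring
  have hB : ∀ ω, |(∫ y, G (s • W ω + b • y) ∂γ) - G (s • W ω) - b ^ 2 * Q ω / 2|
      ≤ K * b ^ 3 * m₃ := fun ω => hGt.abs_integral_gaussian_sub_le hS hb0 _
  have hA' : |∫ ω, (G (t • W ω) - G (s • W ω) - δ * L ω) ∂P| ≤ K * δ ^ 2 * M₂ := by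
    rw [hM₂, ← integral_const_mul]
    exact norm_integral_le_of_norm_le (f := fun ω => G (t • W ω) - G (s • W ω) - δ * L ω)
      .of_finite (Filter.Eventually.of_forall hA)
  have hB' := abs_integral_le_of_forall_abs_le (γ := P) hB
  have hQ' : |∫ ω, Q ω ∂P| ≤ ∑ i, ∑ j, |S i j| * K := by
    refine abs_integral_le_of_forall_abs_le fun ω => ?_
    refine (Finset.abs_sum_le_sum_abs _ _).trans (Finset.sum_le_sum fun i _ => ?_)
    refine (Finset.abs_sum_le_sum_abs _ _).trans (Finset.sum_le_sum fun j _ => ?_)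
    rw [abs_mul]
    exact mul_le_mul_of_nonneg_left (hGt.abs_hess_le i j _) (abs_nonneg _)
  have hibp : |(∫ ω, L ω ∂P) - s * ∫ ω, Q ω ∂P| ≤ ε := by
    have h := hW G G₁ G₂ hGt s hs (hst.trans ht)
    have e : ∫ ω, Q ω ∂P = ∑ i, ∑ j, S i j * ∫ ω, G₂ i j (s • W ω) ∂P := by
      simp only [hQ, integral_finsetSum _ fun _ _ => Integrable.of_finite, integral_const_mul]
    rwa [e]
  rw [integral_sub .of_finite .of_finite, integral_sub .of_finite .of_finite,
    integral_const_mul] at hA'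
  rw [integral_sub .of_finite .of_finite, integral_sub .of_finite .of_finite,
    integral_div, integral_const_mul] at hB'
  rw [et, es]
  set qI := ∫ ω, Q ω ∂P
  set lI := ∫ ω, L ω ∂P
  set u := ∫ ω, G (t • W ω) ∂P
  set v := ∫ ω, G (s • W ω) ∂P
  set w := ∫ ω, ∫ y, G (s • W ω + b • y) ∂γ ∂P
  have hb3 : K * b ^ 3 * m₃ ≤ δ * (√(2 * δ) * (2 * K * m₃)) := by
    have h1 : b ^ 2 ≤ 2 * δ := by rw [hb2]; nlinarith
    have h2 : b ^ 3 ≤ 2 * δ * √(2 * δ) := by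
      rw [pow_succ]; exact mul_le_mul h1 hbδ hb0 (by positivity)
    calc K * b ^ 3 * m₃ ≤ K * (2 * δ * √(2 * δ)) * m₃ := by gcongr
      _ = _ := by ring
  have hid : u - w = (u - v - δ * lI) - (w - v - b ^ 2 * qI / 2) + δ * (lI - s * qI)
      - δ ^ 2 / 2 * qI := by
    rw [hb2]; ring
  have h3 : |δ * (lI - s * qI)| ≤ δ * ε := by
    rw [abs_mul, abs_of_nonneg hδ0]; gcongr
  have h4 : |δ ^ 2 / 2 * qI| ≤ δ ^ 2 * ∑ i, ∑ j, |S i j| * K := by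
    rw [abs_mul, abs_of_nonneg (by positivity)]
    exact mul_le_mul (by nlinarith [sq_nonneg δ]) hQ' (abs_nonneg _) (by positivity)
  rw [hid]
  have t1 := abs_sub (u - v - δ * lI - (w - v - b ^ 2 * qI / 2) + δ * (lI - s * qI))
    (δ ^ 2 / 2 * qI)
  have t2 := abs_add_le (u - v - δ * lI - (w - v - b ^ 2 * qI / 2)) (δ * (lI - s * qI))
  have t3 := abs_sub (u - v - δ * lI) (w - v - b ^ 2 * qI / 2)
  linarith

/-- A random vector that satisfies Gaussian integration by parts up to `ε` is within `ε` of the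
Gaussian vector, tested against functions with Taylor bounds. -/
theorem ApproxIntegrationByParts.abs_integral_sub_le (hW : ApproxIntegrationByParts P W S K ε)
    (hS : S.PosSemidef) (hg : HasTaylorBounds K g g₁ g₂) (hK : 0 ≤ K) :
    |(∫ ω, g (W ω) ∂P) - ∫ y, g y ∂(multivariateGaussian 0 S)| ≤ ε := by
  set A := K * (∫ ω, ‖W ω‖ ^ 2 ∂P) + ∑ i, ∑ j, |S i j| * K
  set B := 2 * K * ∫ y, ‖y‖ ^ 3 ∂(multivariateGaussian 0 S)
  set r : ℝ → ℝ := fun δ => ε + δ * A + √(2 * δ) * B with hr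
  have e0 : smartPath P W S g 0 = ∫ y, g y ∂(multivariateGaussian 0 S) := by simp [smartPath]
  have e1 : smartPath P W S g 1 = ∫ ω, g (W ω) ∂P := by simp [smartPath]
  rw [← e0, ← e1]
  -- the bound for `M + 1` equal steps, whose limit is the claim
  have hM : ∀ M : ℕ, |smartPath P W S g 1 - smartPath P W S g 0| ≤ r (1 / ((M : ℝ) + 1)) := by
    intro M
    have hM0 : (0 : ℝ) < (M : ℝ) + 1 := by positivity
    have hstep : ∀ k ∈ Finset.range (M + 1),
        |smartPath P W S g (((k + 1 : ℕ) : ℝ) / ((M : ℝ) + 1))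
          - smartPath P W S g ((k : ℝ) / ((M : ℝ) + 1))|
          ≤ 1 / ((M : ℝ) + 1) * r (1 / ((M : ℝ) + 1)) := by
      intro k hk
      have hk' : ((k + 1 : ℕ) : ℝ) ≤ (M : ℝ) + 1 := by
        exact_mod_cast Finset.mem_range.1 hk
      have h := abs_smartPath_sub_le hW hS hg hK (s := (k : ℝ) / ((M : ℝ) + 1))
        (t := ((k + 1 : ℕ) : ℝ) / ((M : ℝ) + 1)) (by positivity)
        (by gcongr; simp) ((div_le_one hM0).2 hk')
      have hd : ((k + 1 : ℕ) : ℝ) / ((M : ℝ) + 1) - (k : ℝ) / ((M : ℝ) + 1)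
          = 1 / ((M : ℝ) + 1) := by
        rw [← sub_div]; push_cast; ring
      rwa [hd] at h
    have htel := Finset.sum_range_sub
      (fun k : ℕ => smartPath P W S g ((k : ℝ) / ((M : ℝ) + 1))) (M + 1)
    have hlast : ((M + 1 : ℕ) : ℝ) / ((M : ℝ) + 1) = 1 := by
      push_cast; exact div_self hM0.ne'
    rw [hlast, Nat.cast_zero, zero_div] at htel
    rw [← htel]
    refine (Finset.abs_sum_le_sum_abs _ _).trans ((Finset.sum_le_sum hstep).trans (le_of_eq ?_))
    rw [Finset.sum_const, Finset.card_range, nsmul_eq_mul]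
    push_cast
    field_simp
  have hlim : Filter.Tendsto (fun M : ℕ => r (1 / ((M : ℝ) + 1))) Filter.atTop (nhds ε) := by
    have hc : Continuous r := by fun_prop
    have h0 : r 0 = ε := by simp [hr]
    rw [← h0]
    exact (hc.tendsto 0).comp tendsto_one_div_add_atTop_nhds_zero_nat
  exact ge_of_tendsto' hlim hM

end SmartPath

/-! ### Voxels and lattice cubes on the torus -/

section Torus

lemma addCircle_coe_eq_coe_iff {n : ℕ} {x y : ℝ} :
    (x : AddCircle (n : ℝ)) = y ↔ ∃ k : ℤ, x = y + k * n := by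
  rw [← sub_eq_zero, ← AddCircle.coe_sub, AddCircle.coe_eq_zero_iff]
  refine exists_congr fun k => ?_
  rw [zsmul_eq_mul, eq_comm, sub_eq_iff_eq_add']

lemma fin_eq_of_int_eq {n : ℕ} {z v : Fin n} {k : ℤ} (h : (z : ℤ) = v + k * n) : z = v := by
  have h1 : ((z : ℕ) : ℤ) % n = z := Int.emod_eq_of_lt (by positivity) (by exact_mod_cast z.2)
  have h2 : ((v : ℕ) : ℤ) % n = v := Int.emod_eq_of_lt (by positivity) (by exact_mod_cast v.2)
  rw [h, Int.add_mul_emod_self_right, h2] at h1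
  exact Fin.ext (by lia)

variable {d n : ℕ} [NeZero n]

/-- The corners along one coordinate of the lattice intervals `[z, z + 1]` that contain the point
`a` (if `¬ s`) or the open interval `(a, a + 1)` (if `s`). -/
def side (a : Fin n) (s : Prop) [Decidable s] : Finset (Fin n) :=
  if s then {a} else {a, a - 1}

/-- The corners of the closed voxels that contain the open cube with corner `v` and directions
`S`. -/
def cubeStar (v : Fin d → Fin n) (S : Finset (Fin d)) : Finset (Fin d → Fin n) :=
  Fintype.piFinset fun i => side (v i) (i ∈ S)

lemma fin_add_one_eq_of_int_eq {z v : Fin n} {k : ℤ} (h : (z : ℤ) + 1 = v + k * n) :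
    z + 1 = v := by
  have h2 : (((z + 1 : Fin n) : ℕ) : ℤ) = (((z : ℕ) : ℤ) + 1) % n := by
    rw [Fin.val_add, Fin.val_one', Nat.add_mod_mod]
    push_cast
    rfl
  have h3 : ((v : ℕ) : ℤ) % n = v := Int.emod_eq_of_lt (by positivity) (by exact_mod_cast v.2)
  rw [h, Int.add_mul_emod_self_right, h3] at h2
  exact Fin.ext (by exact_mod_cast h2)

lemma addCircle_coe_fin_add_one (z : Fin n) :
    ((((z + 1 : Fin n) : ℕ) : ℝ) : AddCircle (n : ℝ)) = (((z : ℕ) : ℝ) + 1 : ℝ) := by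
  rw [eq_comm, addCircle_coe_eq_coe_iff]
  have h : ((z + 1 : Fin n) : ℕ) = ((z : ℕ) + 1) % n := by
    rw [Fin.val_add, Fin.val_one', Nat.add_mod_mod]
  obtain ⟨q, hq⟩ : ∃ q, ((z : ℕ) + 1) = ((z : ℕ) + 1) % n + q * n :=
    ⟨((z : ℕ) + 1) / n, (Nat.mod_add_div' _ _).symm⟩
  rw [← h] at hq
  exact ⟨q, by exact_mod_cast hq⟩

lemma image_subset_image_Icc_of_mem_side {z v : Fin n} {s : Prop} [Decidable s]
    (hz : z ∈ side v s) :
    ((↑) : ℝ → AddCircle (n : ℝ)) ''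
        (if s then Set.Ioo ((v : ℕ) : ℝ) ((v : ℕ) + 1) else {((v : ℕ) : ℝ)})
      ⊆ ((↑) : ℝ → AddCircle (n : ℝ)) '' Set.Icc ((z : ℕ) : ℝ) ((z : ℕ) + 1) := by
  by_cases hs : s
  · rw [side, if_pos hs, Finset.mem_singleton] at hz
    rw [if_pos hs, hz]
    exact Set.image_mono Set.Ioo_subset_Icc_self
  · rw [side, if_neg hs, Finset.mem_insert, Finset.mem_singleton] at hz
    rw [if_neg hs, Set.image_singleton, Set.singleton_subset_iff]
    rcases hz with rfl | rfl
    · exact ⟨_, ⟨le_rfl, by linarith⟩, rfl⟩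
    · refine ⟨(((v - 1 : Fin n) : ℕ) : ℝ) + 1, ⟨by linarith, le_rfl⟩, ?_⟩
      rw [← addCircle_coe_fin_add_one, sub_add_cancel]

/-- The midpoint of the lattice interval or point decides which closed intervals contain it. -/
lemma mem_side_of_mem_image_Icc {z v : Fin n} {s : Prop} [Decidable s]
    (h : (((v : ℕ) + if s then 1 / 2 else 0 : ℝ) : AddCircle (n : ℝ))
      ∈ ((↑) : ℝ → AddCircle (n : ℝ)) '' Set.Icc ((z : ℕ) : ℝ) ((z : ℕ) + 1)) :
    z ∈ side v s := by
  obtain ⟨t, ⟨ht1, ht2⟩, ht⟩ := h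
  obtain ⟨k, rfl⟩ := addCircle_coe_eq_coe_iff.1 ht
  by_cases hs : s
  · simp only [if_pos hs] at ht1 ht2
    have h1 : ((z : ℕ) : ℝ) < (v : ℕ) + k * n + 1 := by linarith
    have h2 : ((v : ℕ) : ℝ) + k * n < (z : ℕ) + 1 := by linarith
    have h1' : ((z : ℕ) : ℤ) < (v : ℕ) + k * n + 1 := by exact_mod_cast h1
    have h2' : ((v : ℕ) : ℤ) + k * n < (z : ℕ) + 1 := by exact_mod_cast h2
    simp [side, hs, fin_eq_of_int_eq (show ((z : ℕ) : ℤ) = v + k * n by lia)]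
  · simp only [if_neg hs, add_zero] at ht1 ht2
    have h1' : ((z : ℕ) : ℤ) ≤ (v : ℕ) + k * n := by exact_mod_cast ht1
    have h2' : ((v : ℕ) : ℤ) + k * n ≤ (z : ℕ) + 1 := by exact_mod_cast ht2
    rw [side, if_neg hs, Finset.mem_insert, Finset.mem_singleton, eq_sub_iff_add_eq]
    rcases h1'.eq_or_lt with h | h
    · exact .inl (fin_eq_of_int_eq h)
    · exact .inr (fin_add_one_eq_of_int_eq (k := k) (by lia))

lemma openCube_subset_voxelComplex_iff (ε : (Fin d → Fin n) → ℝ) (v : Fin d → Fin n)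
    (S : Finset (Fin d)) :
    openCube v S ⊆ voxelComplex ε ↔ ∃ z ∈ cubeStar v S, ε z ≠ -1 := by
  constructor
  · intro h
    have hx : (fun i => (((v i : ℕ) + if i ∈ S then 1 / 2 else 0 : ℝ) : AddCircle (n : ℝ)))
        ∈ openCube v S := by
      intro i
      refine ⟨_, ?_, rfl⟩
      by_cases hi : i ∈ S
      · simp only [if_pos hi]; exact ⟨by linarith, by linarith⟩
      · simp [hi]
    obtain ⟨z, hz, hxz⟩ := Set.mem_iUnion₂.1 (h hx)
    exact ⟨z, Fintype.mem_piFinset.2 fun i => mem_side_of_mem_image_Icc (hxz i), hz⟩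
  · rintro ⟨z, hz, hne⟩ x hx
    exact Set.mem_iUnion₂.2 ⟨z, hne, fun i =>
      image_subset_image_Icc_of_mem_side (Fintype.mem_piFinset.1 hz i) (hx i)⟩

/-- The indicator that all the coordinates in `A` are `true`. -/
def allTrue {I : Type*} (A : Finset I) (ω : I → Bool) : ℝ :=
  if ∀ z ∈ A, ω z = true then 1 else 0

/-- Only the cubes all of whose voxels are removed are missing from the voxel model. -/
lemma intrinsicVolume_voxelComplex (j : ℕ) (ε : (Fin d → Fin n) → ℝ) :
    intrinsicVolume j (voxelComplex ε) = ∑ v : Fin d → Fin n, ∑ S : Finset (Fin d),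
      openCubeVolume j S.card * (1 - allTrue (cubeStar v S) fun z => decide (ε z = -1)) := by
  refine Finset.sum_congr rfl fun v _ => Finset.sum_congr rfl fun S _ => ?_
  have h := openCube_subset_voxelComplex_iff ε v S
  by_cases hc : openCube v S ⊆ voxelComplex ε
  · obtain ⟨z, hz, hne⟩ := h.1 hc
    have : ¬ ∀ z ∈ cubeStar v S, ε z = -1 := fun h => hne (h z hz)
    simp [hc, allTrue, this]
  · have : ∀ z ∈ cubeStar v S, ε z = -1 := by simpa using mt h.2 hc
    simp only [if_neg hc, allTrue, decide_eq_true_eq, if_pos this, sub_self, mul_zero]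

end Torus

section Star

variable {d n : ℕ} [NeZero n]

lemma side_subset_side_false (a : Fin n) (s : Prop) [Decidable s] : side a s ⊆ side a False := by
  by_cases hs : s <;> simp [side, hs]

lemma cubeStar_subset_cubeStar_empty (v : Fin d → Fin n) (S : Finset (Fin d)) :
    cubeStar v S ⊆ cubeStar v ∅ := by
  refine Fintype.piFinset_subset _ _ fun i => ?_
  simpa [side] using side_subset_side_false (v i) (i ∈ S)

lemma card_side_le (a : Fin n) (s : Prop) [Decidable s] : (side a s).card ≤ 2 := by
  unfold side
  split_ifs
  · simp
  · exact Finset.card_le_two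

lemma card_cubeStar_le (v : Fin d → Fin n) (S : Finset (Fin d)) : (cubeStar v S).card ≤ 2 ^ d := by
  rw [cubeStar, Fintype.card_piFinset]
  exact (Finset.prod_le_prod' fun i _ => card_side_le (v i) (i ∈ S)).trans (by simp)

/-- The star of a vertex meets at most `4 ^ d` other such stars: each of its at most
`2 ^ d` voxels has at most `2 ^ d` vertices. -/
lemma card_dependencyNbhd_cubeStar_le (v : Fin d → Fin n) :
    (dependencyNbhd (fun w : Fin d → Fin n => cubeStar w ∅) v).card ≤ 4 ^ d := by
  have hsub : dependencyNbhd (fun w : Fin d → Fin n => cubeStar w ∅) v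
      ⊆ (cubeStar v ∅).biUnion fun z => Fintype.piFinset fun i => {z i, z i + 1} := by
    intro w hw
    simp only [dependencyNbhd, Finset.mem_filter, Finset.mem_univ, true_and,
      Finset.not_disjoint_iff] at hw
    obtain ⟨z, hzv, hzw⟩ := hw
    refine Finset.mem_biUnion.2 ⟨z, hzv, Fintype.mem_piFinset.2 fun i => ?_⟩
    have := Fintype.mem_piFinset.1 hzw i
    simp only [side, Finset.notMem_empty, if_false, Finset.mem_insert, Finset.mem_singleton,
      eq_sub_iff_add_eq] at this
    simpa [eq_comm] using this
  refine (Finset.card_le_card hsub).trans ((Finset.card_biUnion_le_card_mul _ _ (2 ^ d)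
    fun z _ => ?_).trans ?_)
  · rw [Fintype.card_piFinset]
    exact (Finset.prod_le_prod' fun i _ => Finset.card_le_two).trans (by simp)
  · calc _ ≤ 2 ^ d * 2 ^ d := Nat.mul_le_mul_right _ (card_cubeStar_le v ∅)
      _ = 4 ^ d := by rw [← mul_pow]; norm_num

end Star

/-! ### The generating function of the numbers of pairs of cubes -/

section GeneratingFunction

lemma sum_finset_prod_mem {R : Type*} [CommSemiring R] {d : ℕ} (f : Fin d → Bool → R) :
    ∑ S : Finset (Fin d), ∏ i, f i (decide (i ∈ S)) = ∏ i, ∑ b, f i b := by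
  have h := Finset.prod_add (fun i => f i true) (fun i => f i false) Finset.univ
  simp only [Finset.powerset_univ] at h
  simp only [Fintype.sum_bool, h]
  refine Finset.sum_congr rfl fun S _ => ?_
  rw [← Finset.prod_mul_prod_compl S]
  congr 1
  · exact Finset.prod_congr rfl fun i hi => by simp [hi]
  · rw [← Finset.compl_eq_univ_sdiff]
    exact Finset.prod_congr rfl fun i hi => by simp [Finset.mem_compl.1 hi]

/-- A sum over pairs of lattice cubes of a product over the coordinates is a power of the sum over
the pairs of one-dimensional cubes. -/
lemma sum_pairs_prod {R : Type*} [CommSemiring R] {d n : ℕ}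
    (f : Fin n → Bool → Fin n → Bool → R) :
    ∑ v : Fin d → Fin n, ∑ S : Finset (Fin d), ∑ w : Fin d → Fin n, ∑ T : Finset (Fin d),
      ∏ i, f (v i) (decide (i ∈ S)) (w i) (decide (i ∈ T))
      = (∑ a, ∑ s, ∑ b, ∑ t, f a s b t) ^ d := by
  have h1 : ∀ (v : Fin d → Fin n) (S : Finset (Fin d)),
      ∑ w : Fin d → Fin n, ∑ T : Finset (Fin d),
        ∏ i, f (v i) (decide (i ∈ S)) (w i) (decide (i ∈ T))
      = ∏ i, ∑ b, ∑ t, f (v i) (decide (i ∈ S)) b t := fun v S => by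
    rw [Finset.prod_univ_sum, Fintype.piFinset_univ]
    refine Finset.sum_congr rfl fun w _ => ?_
    exact sum_finset_prod_mem fun i t => f (v i) (decide (i ∈ S)) (w i) t
  simp only [h1]
  have h2 : ∀ v : Fin d → Fin n,
      ∑ S : Finset (Fin d), ∏ i, ∑ b, ∑ t, f (v i) (decide (i ∈ S)) b t
      = ∏ i, ∑ s, ∑ b, ∑ t, f (v i) s b t := fun v =>
    sum_finset_prod_mem fun i s => ∑ b, ∑ t, f (v i) s b t
  simp only [h2]
  rw [← Fin.prod_const, Finset.prod_univ_sum, Fintype.piFinset_univ]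

lemma add_two_pow_eq_sum {R : Type*} [CommRing R] [Algebra ℝ R] (x : R) {l d : ℕ} (hl : l ≤ d) :
    (x + 2) ^ l = ∑ a ∈ Finset.range (d + 1), ((l.choose a : ℝ) * 2 ^ (l - a)) • x ^ a := by
  rw [add_pow]
  refine (Finset.sum_subset (Finset.range_mono (by lia)) fun a _ ha => ?_).trans
    (Finset.sum_congr rfl fun a _ => ?_)
  · rw [Nat.choose_eq_zero_of_lt (by simpa using ha)]; simp
  · rw [Algebra.smul_def, map_mul, map_natCast, map_pow, map_ofNat]
    ring

/-- The numbers `(d choose δ) * N_{a,b,δ}` are the coefficients of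
`(1 + z ((x + 2) (y + 2) - 2)) ^ d`. -/
lemma pairCount_generating_function {R : Type*} [CommRing R] [Algebra ℝ R] (x y z : R) (d : ℕ) :
    (1 + z * ((x + 2) * (y + 2) - 2)) ^ d
      = ∑ a ∈ Finset.range (d + 1), ∑ b ∈ Finset.range (d + 1), ∑ δ ∈ Finset.range (d + 1),
        ((d.choose δ : ℝ) * pairCount a b δ) • (z ^ δ * x ^ a * y ^ b) := by
  have hE : ∀ δ ∈ Finset.range (d + 1), ((x + 2) * (y + 2) - 2) ^ δ
      = ∑ a ∈ Finset.range (d + 1), ∑ b ∈ Finset.range (d + 1),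
        pairCount a b δ • (x ^ a * y ^ b) := by
    intro δ hδ
    have hδ' : δ ≤ d := by simpa [Nat.lt_succ_iff] using hδ
    have hterm : ∀ l ∈ Finset.range (δ + 1), ((x + 2) * (y + 2)) ^ l * (-2) ^ (δ - l)
        * (δ.choose l : R) = ∑ a ∈ Finset.range (d + 1), ∑ b ∈ Finset.range (d + 1),
          ((-1 : ℝ) ^ (δ - l) * (δ.choose l : ℝ) * (l.choose a : ℝ) * (l.choose b : ℝ)
            * (2 : ℝ) ^ ((δ : ℤ) + l - a - b)) • (x ^ a * y ^ b) := by
      intro l hl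
      have hl' : l ≤ δ := by simpa [Nat.lt_succ_iff] using hl
      rw [mul_pow, add_two_pow_eq_sum x (hl'.trans hδ'), add_two_pow_eq_sum y (hl'.trans hδ'),
        Finset.sum_mul_sum, mul_assoc, Finset.sum_mul]
      refine Finset.sum_congr rfl fun a _ => ?_
      rw [Finset.sum_mul]
      refine Finset.sum_congr rfl fun b _ => ?_
      rcases lt_or_ge l a with ha | ha
      · simp [Nat.choose_eq_zero_of_lt ha]
      rcases lt_or_ge l b with hb | hb
      · simp [Nat.choose_eq_zero_of_lt hb]
      have h2 : (2 : ℝ) ^ ((δ : ℤ) + l - a - b) = 2 ^ (δ - l) * 2 ^ (l - a) * 2 ^ (l - b) := by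
        rw [← pow_add, ← pow_add, ← zpow_natCast]
        congr 1
        lia
      have h3 : ((-2 : R)) ^ (δ - l) = algebraMap ℝ R ((-1) ^ (δ - l) * 2 ^ (δ - l)) := by
        rw [← mul_pow, map_pow, map_mul, map_neg, map_one, map_ofNat, neg_one_mul]
      have h4 : (δ.choose l : R) = algebraMap ℝ R (δ.choose l : ℝ) := by simp
      rw [h2, h3, h4]
      simp only [Algebra.smul_def, map_mul]
      ring
    rw [sub_eq_add_neg, add_pow, Finset.sum_congr rfl hterm, Finset.sum_comm]
    refine Finset.sum_congr rfl fun a _ => ?_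
    rw [Finset.sum_comm]
    refine Finset.sum_congr rfl fun b _ => ?_
    rw [← Finset.sum_smul, pairCount]
  rw [add_comm, add_pow]
  have hδ : ∀ δ ∈ Finset.range (d + 1),
      (z * ((x + 2) * (y + 2) - 2)) ^ δ * 1 ^ (d - δ) * (d.choose δ : R)
      = ∑ a ∈ Finset.range (d + 1), ∑ b ∈ Finset.range (d + 1),
        ((d.choose δ : ℝ) * pairCount a b δ) • (z ^ δ * x ^ a * y ^ b) := by
    intro δ hδ
    rw [mul_pow, hE δ hδ, Finset.mul_sum, one_pow, mul_one, Finset.sum_mul]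
    refine Finset.sum_congr rfl fun a _ => ?_
    rw [Finset.mul_sum, Finset.sum_mul]
    refine Finset.sum_congr rfl fun b _ => ?_
    have h4 : (d.choose δ : R) = algebraMap ℝ R (d.choose δ : ℝ) := by simp
    rw [h4]
    simp only [Algebra.smul_def, map_mul]
    ring
  rw [Finset.sum_congr rfl hδ, Finset.sum_comm]
  exact Finset.sum_congr rfl fun a _ => Finset.sum_comm

end GeneratingFunction

/-! ### Counting pairs of cubes by the dimension of their join -/

section PairCounting

variable {n : ℕ} [NeZero n]

/-- The weight of a pair of one-dimensional lattice cubes: it vanishes if no lattice interval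
contains both, and is otherwise a monomial whose exponents record the dimensions of the two cubes
and of their join. The cubes with a one-dimensional join lie in exactly one common lattice
interval, equal vertices lie in two. -/
def pairWeight {R : Type*} [CommRing R] (x y z : R) (a : Fin n) (s : Bool) (b : Fin n) (t : Bool) :
    R :=
  (if (side a (s = true) ∩ side b (t = true)).card = 0 then 0
    else if (side a (s = true) ∩ side b (t = true)).card = 1 then z else 1)
    * x ^ s.toNat * y ^ t.toNat

/-- The lattice points `a - 1`, `a`, `a + 1` are distinct. For `n ≤ 2` they are not, and the counts
of common voxels would be different. -/
lemma fin_add_one_ne (hn : 3 ≤ n) (a : Fin n) : a + 1 ≠ a ∧ a - 1 ≠ a ∧ a + 1 ≠ a - 1 := by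
  have h1 : (1 : Fin n) ≠ 0 := by
    intro h
    have := congrArg Fin.val h
    rw [Fin.val_one', Nat.mod_eq_of_lt (by lia)] at this
    simp at this
  have h2 : (1 + 1 : Fin n) ≠ 0 := by
    intro h
    have := congrArg Fin.val h
    rw [Fin.val_add, Fin.val_one', Nat.mod_eq_of_lt (a := 1) (by lia),
      Nat.mod_eq_of_lt (by lia)] at this
    simp at this
  refine ⟨by simpa using h1, by simpa [sub_eq_iff_eq_add] using h1, fun h => h2 ?_⟩
  rw [eq_sub_iff_add_eq, add_assoc] at h
  simpa using h

lemma sum_pairWeight {R : Type*} [CommRing R] (x y z : R) (hn : 3 ≤ n) (a : Fin n) :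
    ∑ s, ∑ b, ∑ t, pairWeight x y z a s b t = 1 + z * ((x + 2) * (y + 2) - 2) := by
  obtain ⟨h1, h2, h3⟩ := fin_add_one_ne hn a
  have tt : ∀ b, pairWeight x y z a true b true = if b = a then z * x * y else 0 := by
    intro b
    by_cases hb : b = a
    · subst hb; simp [pairWeight, side]
    · simp [pairWeight, side, hb]
  have tf : ∀ b, pairWeight x y z a true b false
      = (if b = a then z * x else 0) + if b = a + 1 then z * x else 0 := by
    intro b
    by_cases hb : b = a
    · subst hb
      have : ({b} ∩ {b, b - 1} : Finset (Fin n)) = {b} := by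
        rw [Finset.inter_eq_left]; simp
      simp [pairWeight, side, h1.symm, this]
    by_cases hb' : b = a + 1
    · subst hb'; simp [pairWeight, side, h1]
    · have : a ≠ b - 1 := fun h => hb' (by rw [h, sub_add_cancel])
      simp [pairWeight, side, hb, hb', this]
  have ft : ∀ b, pairWeight x y z a false b true
      = (if b = a then z * y else 0) + if b = a - 1 then z * y else 0 := by
    intro b
    by_cases hb : b = a
    · subst hb; simp [pairWeight, side, h2.symm]
    by_cases hb' : b = a - 1
    · subst hb'; simp [pairWeight, side, h2]
    · simp [pairWeight, side, hb, hb']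
  have ff : ∀ b, pairWeight x y z a false b false
      = (if b = a then 1 else 0) + (if b = a + 1 then z else 0)
        + if b = a - 1 then z else 0 := by
    intro b
    by_cases hb : b = a
    · subst hb
      have : ({b, b - 1} : Finset (Fin n)).card = 2 := Finset.card_pair h2.symm
      simp [pairWeight, side, h1.symm, h2.symm, this]
    by_cases hb' : b = a + 1
    · subst hb'
      have : ({a, a - 1} ∩ {a + 1, a} : Finset (Fin n)) = {a} := by
        ext c
        simp only [Finset.mem_inter, Finset.mem_insert, Finset.mem_singleton]
        constructor
        · rintro ⟨rfl | rfl, h | h⟩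
          · rfl
          · rfl
          · exact absurd h.symm h3
          · exact h
        · rintro rfl; simp
      simp [pairWeight, side, h1, h3, this]
    by_cases hb'' : b = a - 1
    · subst hb''
      have h4 : a - 1 - 1 ≠ a := fun h => h3 (by
        rw [sub_eq_iff_eq_add] at h; exact h.symm)
      have : ({a, a - 1} ∩ {a - 1, a - 1 - 1} : Finset (Fin n)) = {a - 1} := by
        ext c
        simp only [Finset.mem_inter, Finset.mem_insert, Finset.mem_singleton]
        constructor
        · rintro ⟨rfl | rfl, h | h⟩
          · exact h
          · exact absurd h.symm h4
          · rfl
          · rfl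
        · rintro rfl; simp
      simp [pairWeight, side, h2, h3.symm, this]
    · have : ({a, a - 1} ∩ {b, b - 1} : Finset (Fin n)) = ∅ := by
        ext c
        simp only [Finset.mem_inter, Finset.mem_insert, Finset.mem_singleton, Finset.notMem_empty,
          iff_false]
        rintro ⟨rfl | rfl, h | h⟩
        · exact hb h.symm
        · exact hb' (by rw [h, sub_add_cancel])
        · exact hb'' h.symm
        · exact hb (sub_left_injective h).symm
      simp [pairWeight, side, hb, hb', hb'', this]
  simp only [Fintype.sum_bool, tt, tf, ft, ff, Finset.sum_add_distrib, Finset.sum_ite_eq',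
    Finset.mem_univ, if_true]
  ring

variable {d : ℕ}

/-- The product of the weights along the coordinates: either the two cubes have no common voxel, or
they have `2 ^ (d - δ)`, where `δ` is the dimension of their join. -/
lemma prod_pairWeight {R : Type*} [CommRing R] (x y z : R) (v w : Fin d → Fin n)
    (S T : Finset (Fin d)) :
    ((cubeStar v S ∩ cubeStar w T).card = 0 ∧
      ∏ i, pairWeight x y z (v i) (decide (i ∈ S)) (w i) (decide (i ∈ T)) = 0) ∨
    ∃ δ ≤ d, (cubeStar v S ∩ cubeStar w T).card = 2 ^ (d - δ) ∧
      ∏ i, pairWeight x y z (v i) (decide (i ∈ S)) (w i) (decide (i ∈ T))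
        = z ^ δ * x ^ S.card * y ^ T.card := by
  set c : Fin d → ℕ := fun i => (side (v i) (i ∈ S) ∩ side (w i) (i ∈ T)).card with hc
  have hcard : (cubeStar v S ∩ cubeStar w T).card = ∏ i, c i := by
    rw [cubeStar, cubeStar, ← Fintype.piFinset_inter, Fintype.card_piFinset]
  have hw : ∀ i, pairWeight x y z (v i) (decide (i ∈ S)) (w i) (decide (i ∈ T))
      = (if c i = 0 then 0 else if c i = 1 then z else 1)
        * (if i ∈ S then x else 1) * (if i ∈ T then y else 1) := fun i => by
    by_cases hS : i ∈ S <;> by_cases hT : i ∈ T <;> simp [pairWeight, hc, hS, hT]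
  have hc2 : ∀ i, c i ≤ 2 := fun i =>
    (Finset.card_le_card Finset.inter_subset_left).trans (card_side_le _ _)
  rw [hcard]
  simp only [hw]
  by_cases h0 : ∃ i, c i = 0
  · obtain ⟨i, hi⟩ := h0
    exact .inl ⟨Finset.prod_eq_zero (Finset.mem_univ i) hi,
      Finset.prod_eq_zero (Finset.mem_univ i) (by simp [hi])⟩
  · have h0' : ∀ i, c i ≠ 0 := fun i hi => h0 ⟨i, hi⟩
    set A := Finset.univ.filter fun i => c i = 1 with hA
    refine .inr ⟨A.card, by simpa using Finset.card_le_univ A, ?_, ?_⟩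
    · have : ∀ i, c i = if i ∈ Aᶜ then 2 else 1 := fun i => by
        have := hc2 i
        have := h0' i
        by_cases h1 : c i = 1
        · simp [hA, h1]
        · simp [hA, h1]; lia
      rw [Finset.prod_congr rfl fun i _ => this i]
      rw [Finset.prod_ite_mem, Finset.univ_inter, Finset.prod_const, Finset.card_compl,
        Fintype.card_fin]
    · simp only [h0', if_false, Finset.prod_mul_distrib]
      simp [Finset.prod_ite, hA]

/-- Counting the pairs of lattice cubes by their dimensions and by the dimension of their join:
there are `n ^ d * (d choose δ) * N_{a,b,δ}` pairs of dimensions `a`, `b` with a join of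
dimension `δ`, and two cubes with a join of dimension `δ` have `2 ^ (d - δ)` common voxels. The
summand `H a b c` is a function of the dimensions `a`, `b` and of the number `c` of common voxels,
and `F a b δ` is its value in terms of `δ`. -/
lemma sum_pairs_eq (hn : 3 ≤ n) (F : ℕ → ℕ → ℕ → ℝ) (H : ℕ → ℕ → ℕ → ℝ)
    (hH0 : ∀ a b, H a b 0 = 0) (hHF : ∀ a b δ, δ ≤ d → H a b (2 ^ (d - δ)) = F a b δ) :
    ∑ v : Fin d → Fin n, ∑ S : Finset (Fin d), ∑ w : Fin d → Fin n, ∑ T : Finset (Fin d),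
      H S.card T.card (cubeStar v S ∩ cubeStar w T).card
      = (n : ℝ) ^ d * ∑ a ∈ Finset.range (d + 1), ∑ b ∈ Finset.range (d + 1),
        ∑ δ ∈ Finset.range (d + 1), (d.choose δ : ℝ) * pairCount a b δ * F a b δ := by
  -- the linear functional that reads off `F` from the exponents of a monomial
  set Λ : MvPolynomial (Fin 3) ℝ →ₗ[ℝ] ℝ :=
    (MvPolynomial.basisMonomials (Fin 3) ℝ).constr ℝ (fun m => F (m 0) (m 1) (m 2)) with hΛ
  set x : MvPolynomial (Fin 3) ℝ := MvPolynomial.X 0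
  set y : MvPolynomial (Fin 3) ℝ := MvPolynomial.X 1
  set z : MvPolynomial (Fin 3) ℝ := MvPolynomial.X 2
  have hmon : ∀ a b δ, Λ (z ^ δ * x ^ a * y ^ b) = F a b δ := by
    intro a b δ
    have : z ^ δ * x ^ a * y ^ b = MvPolynomial.basisMonomials (Fin 3) ℝ
        (Finsupp.single 2 δ + Finsupp.single 0 a + Finsupp.single 1 b) := by
      simp [x, y, z, MvPolynomial.X_pow_eq_monomial, MvPolynomial.monomial_mul]
    rw [this, hΛ, Module.Basis.constr_basis]
    simp
  have hterm : ∀ (v w : Fin d → Fin n) (S T : Finset (Fin d)),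
      H S.card T.card (cubeStar v S ∩ cubeStar w T).card
      = Λ (∏ i, pairWeight x y z (v i) (decide (i ∈ S)) (w i) (decide (i ∈ T))) := by
    intro v w S T
    rcases prod_pairWeight x y z v w S T with ⟨h1, h2⟩ | ⟨δ, hδ, h1, h2⟩
    · rw [h1, h2, hH0, map_zero]
    · rw [h1, h2, hmon, hHF _ _ _ hδ]
  simp only [hterm, ← map_sum]
  rw [sum_pairs_prod (pairWeight x y z)]
  simp only [sum_pairWeight x y z hn]
  rw [Finset.sum_const, Finset.card_univ, Fintype.card_fin, nsmul_eq_mul, mul_pow,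
    pairCount_generating_function]
  have : ((n : MvPolynomial (Fin 3) ℝ)) ^ d = MvPolynomial.C ((n : ℝ) ^ d) := by simp
  rw [this, ← MvPolynomial.smul_eq_C_mul, map_smul, smul_eq_mul]
  simp only [map_sum, map_smul, hmon, smul_eq_mul]

end PairCounting

/-! ### The covariance of the intrinsic volumes -/

section Covariance

variable {I : Type*} {ν : Measure Bool} [IsProbabilityMeasure ν]

lemma allTrue_mul [DecidableEq I] (A B : Finset I) (ω : I → Bool) :
    allTrue A ω * allTrue B ω = allTrue (A ∪ B) ω := by
  simp only [allTrue, Finset.mem_union, or_imp, forall_and, ite_and]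
  split_ifs <;> simp

lemma abs_sub_allTrue_le {r : ℝ} (hr0 : 0 ≤ r) (hr1 : r ≤ 1) (A : Finset I) (ω : I → Bool) :
    |r - allTrue A ω| ≤ 1 := by
  rw [allTrue, abs_le]
  split_ifs <;> constructor <;> linarith

lemma dependsOn_allTrue (A : Finset I) : DependsOn (allTrue A) (A : Set I) := by
  intro ω ω' h
  have : (∀ z ∈ A, ω z = true) ↔ ∀ z ∈ A, ω' z = true :=
    forall₂_congr fun z hz => by rw [h z hz]
  simp only [allTrue, this]

variable [Fintype I] {q : ℝ}

lemma integral_allTrue (hq : ν.real {true} = q) (A : Finset I) :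
    ∫ ω, allTrue A ω ∂(Measure.pi fun _ : I => ν) = q ^ A.card := by
  classical
  have h1 : ∀ ω : I → Bool,
      allTrue A ω = ∏ z, if z ∈ A then (if ω z = true then (1 : ℝ) else 0) else 1 := by
    intro ω
    rw [Finset.prod_ite_mem, Finset.univ_inter, Finset.prod_ite_zero]
    simp [allTrue]
  simp only [h1]
  rw [integral_fintype_prod_eq_prod
    (f := fun z (b : Bool) => if z ∈ A then (if b = true then (1 : ℝ) else 0) else 1)]
  have h2 : ∀ z, ∫ b : Bool, (if z ∈ A then (if b = true then (1 : ℝ) else 0) else 1) ∂ν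
      = if z ∈ A then q else 1 := by
    intro z
    by_cases hz : z ∈ A
    · simp [hz, integral_fintype, hq]
    · simp only [if_neg hz, integral_const, probReal_univ, smul_eq_mul, mul_one]
  simp [h2]

lemma integral_pow_sub_allTrue (hq : ν.real {true} = q) (A : Finset I) :
    ∫ ω, (q ^ A.card - allTrue A ω) ∂(Measure.pi fun _ : I => ν) = 0 := by
  rw [integral_sub .of_finite .of_finite, integral_allTrue hq]
  simp

lemma integral_pow_sub_allTrue_mul [DecidableEq I] (hq : ν.real {true} = q)
    (hq0 : q ≠ 0) (A B : Finset I) :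
    ∫ ω, (q ^ A.card - allTrue A ω) * (q ^ B.card - allTrue B ω)
        ∂(Measure.pi fun _ : I => ν)
      = q ^ (A.card + B.card) * ((q ^ (A ∩ B).card)⁻¹ - 1) := by
  have h1 : ∀ ω, (q ^ A.card - allTrue A ω) * (q ^ B.card - allTrue B ω)
      = q ^ A.card * (q ^ B.card - allTrue B ω) - (q ^ B.card * allTrue A ω
        - allTrue (A ∪ B) ω) := fun ω => by
    rw [← allTrue_mul]; ring
  simp only [h1]
  rw [integral_sub .of_finite .of_finite, integral_const_mul, integral_pow_sub_allTrue hq,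
    integral_sub .of_finite .of_finite, integral_const_mul, integral_allTrue hq,
    integral_allTrue hq,
    mul_zero, zero_sub, neg_sub, mul_sub, mul_one, ← pow_add, add_comm B.card,
    ← Finset.card_union_add_card_inter A B, pow_add q (A ∪ B).card,
    mul_inv_cancel_right₀ (pow_ne_zero _ hq0)]

variable {d n : ℕ} [NeZero n]

/-- The contribution of the cubes with corner `v` to the normalized vector of intrinsic volumes,
where `ω z = true` means that the voxel `z` is removed. -/
def siteVolume (q : ℝ) (v : Fin d → Fin n) (ω : (Fin d → Fin n) → Bool) :
    EuclideanSpace ℝ (Fin (d + 1)) :=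
  WithLp.toLp 2 fun j : Fin (d + 1) => (n : ℝ) ^ (-(d : ℝ) / 2) *
    ∑ S : Finset (Fin d), openCubeVolume j S.card *
      (q ^ (cubeStar v S).card - allTrue (cubeStar v S) ω)

lemma norm_le_sum_abs {ι : Type*} [Fintype ι] (x : EuclideanSpace ℝ ι) : ‖x‖ ≤ ∑ i, |x i| := by
  rw [EuclideanSpace.norm_eq]
  refine Real.sqrt_le_iff.2 ⟨Finset.sum_nonneg fun i _ => abs_nonneg _, ?_⟩
  exact Finset.sum_sq_le_sq_sum_of_nonneg fun i _ => norm_nonneg _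

lemma norm_siteVolume_le (hq0 : 0 ≤ q) (hq1 : q ≤ 1) (v : Fin d → Fin n)
    (ω : (Fin d → Fin n) → Bool) :
    ‖siteVolume q v ω‖ ≤ (n : ℝ) ^ (-(d : ℝ) / 2) *
      ∑ j : Fin (d + 1), ∑ S : Finset (Fin d), |openCubeVolume j S.card| := by
  refine (norm_le_sum_abs _).trans ?_
  rw [Finset.mul_sum]
  refine Finset.sum_le_sum fun j _ => ?_
  rw [siteVolume, abs_mul, abs_of_nonneg (by positivity)]
  gcongr
  refine (Finset.abs_sum_le_sum_abs _ _).trans (Finset.sum_le_sum fun S _ => ?_)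
  rw [abs_mul]
  exact mul_le_of_le_one_right (abs_nonneg _)
    (abs_sub_allTrue_le (by positivity) (pow_le_one₀ hq0 hq1) _ _)

lemma isLocallyDependent_siteVolume (hq : ν.real {true} = q) :
    IsLocallyDependent ν (fun v : Fin d → Fin n => cubeStar v ∅) (siteVolume q)
      ((n : ℝ) ^ (-(d : ℝ) / 2) *
        ∑ j : Fin (d + 1), ∑ S : Finset (Fin d), |openCubeVolume j S.card|) (4 ^ d) where
  dependsOn v ω ω' h := by
    have : ∀ S, allTrue (cubeStar v S) ω = allTrue (cubeStar v S) ω' := fun S =>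
      dependsOn_allTrue _ fun z hz => h z (cubeStar_subset_cubeStar_empty v S hz)
    simp only [siteVolume, this]
  integral_eq_zero v j := by
    simp only [siteVolume]
    rw [integral_const_mul, integral_finsetSum _ fun _ _ => .of_finite]
    simp [integral_const_mul, integral_pow_sub_allTrue hq]
  norm_le := norm_siteVolume_le (hq ▸ measureReal_nonneg) (hq ▸ measureReal_le_one)
  card_le := card_dependencyNbhd_cubeStar_le

lemma card_cubeStar (hn : 3 ≤ n) (v : Fin d → Fin n) (S : Finset (Fin d)) :
    (cubeStar v S).card = 2 ^ (d - S.card) := by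
  rw [cubeStar, Fintype.card_piFinset]
  have : ∀ i, (side (v i) (i ∈ S)).card = if i ∈ Sᶜ then 2 else 1 := fun i => by
    by_cases hi : i ∈ S
    · simp [side, hi]
    · simp [side, hi, Finset.card_pair (fin_add_one_ne hn (v i)).2.1.symm]
  rw [Finset.prod_congr rfl fun i _ => this i, Finset.prod_ite_mem, Finset.univ_inter,
    Finset.prod_const, Finset.card_compl, Fintype.card_fin]

/-- On the torus with `n ≥ 3` the covariance matrix is exactly `Σ`, without a boundary term. -/
lemma integral_sum_siteVolume_mul (hn : 3 ≤ n) {p : ℝ} (hp1 : p < 1) (hν : ν.real {true} = 1 - p)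
    (i j : Fin (d + 1)) :
    ∫ ω, (∑ v : Fin d → Fin n, siteVolume (1 - p) v ω) i
        * (∑ v : Fin d → Fin n, siteVolume (1 - p) v ω) j
        ∂(Measure.pi fun _ : Fin d → Fin n => ν) = covMatrix d p i j := by
  have hq0 : 1 - p ≠ 0 := by linarith
  have hn0 : (0 : ℝ) < n := by exact_mod_cast (by lia : 0 < n)
  have hsq : (n : ℝ) ^ (-(d : ℝ) / 2) * (n : ℝ) ^ (-(d : ℝ) / 2) * (n : ℝ) ^ d = 1 := by
    rw [← Real.rpow_add hn0, ← Real.rpow_natCast, ← Real.rpow_add hn0]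
    ring_nf
    simp
  have hW : ∀ ω, (∑ v : Fin d → Fin n, siteVolume (1 - p) v ω) i
        * (∑ v : Fin d → Fin n, siteVolume (1 - p) v ω) j
      = (n : ℝ) ^ (-(d : ℝ) / 2) * (n : ℝ) ^ (-(d : ℝ) / 2) *
        ∑ v : Fin d → Fin n, ∑ S : Finset (Fin d), ∑ w : Fin d → Fin n, ∑ T : Finset (Fin d),
          openCubeVolume i S.card * openCubeVolume j T.card *
            (((1 - p) ^ (cubeStar v S).card - allTrue (cubeStar v S) ω)
              * ((1 - p) ^ (cubeStar w T).card - allTrue (cubeStar w T) ω)) := by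
    intro ω
    simp only [siteVolume, WithLp.ofLp_sum, Finset.sum_apply, ← Finset.mul_sum]
    rw [mul_mul_mul_comm, Finset.sum_mul]
    congr 1
    refine Finset.sum_congr rfl fun v _ => ?_
    rw [Finset.sum_mul]
    refine Finset.sum_congr rfl fun S _ => ?_
    rw [Finset.mul_sum]
    refine Finset.sum_congr rfl fun w _ => ?_
    rw [Finset.mul_sum]
    refine Finset.sum_congr rfl fun T _ => ?_
    ring
  simp only [hW, integral_const_mul, integral_finsetSum _ fun _ _ => Integrable.of_finite,
    integral_pow_sub_allTrue_mul hν hq0]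
  simp only [card_cubeStar hn]
  have hcount := sum_pairs_eq (d := d) hn
    (fun a b δ => openCubeVolume i a * openCubeVolume j b
      * ((1 - p) ^ (2 ^ (d - a) + 2 ^ (d - b)) * (((1 - p) ^ (2 ^ (d - δ)))⁻¹ - 1)))
    (fun a b c => openCubeVolume i a * openCubeVolume j b
      * ((1 - p) ^ (2 ^ (d - a) + 2 ^ (d - b)) * (((1 - p) ^ c)⁻¹ - 1)))
    (fun a b => by simp) (fun a b δ _ => rfl)
  change _ = covConst d p i j
  rw [hcount, ← mul_assoc, hsq, one_mul, covConst]
  refine Finset.sum_congr rfl fun a _ => Finset.sum_congr rfl fun b _ =>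
    Finset.sum_congr rfl fun δ _ => ?_
  ring

end Covariance

/-! ### The rate of convergence -/

section Conclusion

/-- The law of the indicator that a given voxel is removed. -/
def removalLaw (p : ℝ) : Measure Bool :=
  ENNReal.ofReal (1 - p) • Measure.dirac true + ENNReal.ofReal p • Measure.dirac false

lemma isProbabilityMeasure_removalLaw {p : ℝ} (hp0 : 0 < p) (hp1 : p < 1) :
    IsProbabilityMeasure (removalLaw p) := by
  refine ⟨?_⟩
  rw [removalLaw]
  simp only [Measure.coe_add, Measure.coe_smul, Pi.add_apply, Pi.smul_apply, measure_univ,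
    smul_eq_mul, mul_one]
  rw [← ENNReal.ofReal_add (by linarith) hp0.le]
  simp

lemma removalLaw_real_true {p : ℝ} (hp1 : p < 1) : (removalLaw p).real {true} = 1 - p := by
  simp [removalLaw, Measure.real, hp1.le]

lemma posSemidef_covMatrix {d : ℕ} {p : ℝ} (hp0 : 0 < p) (hp1 : p < 1) :
    (covMatrix d p).PosSemidef := by
  have := isProbabilityMeasure_removalLaw hp0 hp1
  -- any `n ≥ 3` represents the matrix as a covariance matrix
  have h := integral_sum_siteVolume_mul (d := d) (n := 3) le_rfl hp1 (removalLaw_real_true hp1)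
  set W : ((Fin d → Fin 3) → Bool) → EuclideanSpace ℝ (Fin (d + 1)) := fun ω =>
    ∑ v : Fin d → Fin 3, siteVolume (1 - p) v ω
  refine Matrix.PosSemidef.of_dotProduct_mulVec_nonneg ?_ fun x => ?_
  · ext i j
    rw [Matrix.conjTranspose_apply, ← h, ← h]
    simp [mul_comm]
  · have : star x ⬝ᵥ (covMatrix d p).mulVec x
        = ∫ ω, (∑ i, x i * W ω i) ^ 2 ∂(Measure.pi fun _ : Fin d → Fin 3 => removalLaw p) := by
      have hsq : ∀ ω, (∑ i, x i * W ω i) ^ 2 = ∑ i, ∑ j, x i * x j * (W ω i * W ω j) := fun ω => by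
        rw [sq, Finset.sum_mul_sum]
        exact Finset.sum_congr rfl fun i _ => Finset.sum_congr rfl fun j _ => by ring
      simp only [hsq, integral_finsetSum _ fun _ _ => Integrable.of_finite, integral_const_mul,
        show ∀ i j, ∫ ω, W ω i * W ω j ∂(Measure.pi fun _ : Fin d → Fin 3 => removalLaw p)
          = covMatrix d p i j from h]
      simp only [dotProduct, Matrix.mulVec, Finset.mul_sum, Pi.star_apply, star_trivial]
      exact Finset.sum_congr rfl fun i _ => Finset.sum_congr rfl fun j _ => by ring
    rw [this]
    exact integral_nonneg fun ω => sq_nonneg _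

lemma measurable_decide_eq_neg_one : Measurable fun x : ℝ => decide (x = -1) := by
  refine measurable_to_bool ?_
  have : (fun x : ℝ => decide (x = -1)) ⁻¹' {true} = {-1} := by ext x; simp
  rw [this]
  exact measurableSet_singleton _

lemma measurable_removal {I Ω : Type*} [MeasurableSpace Ω] {X : I → Ω → ℝ}
    (hX : ∀ z, Measurable (X z)) : Measurable fun ω z => decide (X z ω = -1) :=
  measurable_pi_lambda _ fun z => measurable_decide_eq_neg_one.comp (hX z)

/-- Independent voxels are removed independently with probability `1 - p`. -/
lemma map_removal_eq_pi {I Ω : Type*} [Fintype I] [MeasurableSpace Ω] {P : Measure Ω}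
    [IsProbabilityMeasure P] {p : ℝ} (hp0 : 0 < p) (hp1 : p < 1) {X : I → Ω → ℝ}
    (hX : ∀ z, Measurable (X z)) (hind : iIndepFun X P)
    (hlaw : ∀ z, P.real {ω | X z ω = -1} = 1 - p) :
    P.map (fun ω z => decide (X z ω = -1)) = Measure.pi fun _ : I => removalLaw p := by
  have hmap : ∀ z, P.map (fun ω => decide (X z ω = -1)) = removalLaw p := by
    intro z
    have hm : Measurable fun ω => decide (X z ω = -1) := measurable_decide_eq_neg_one.comp (hX z)
    have := isProbabilityMeasure_removalLaw hp0 hp1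
    have := Measure.isProbabilityMeasure_map (μ := P) hm.aemeasurable
    have ht : (P.map fun ω => decide (X z ω = -1)).real {true} = (removalLaw p).real {true} := by
      rw [removalLaw_real_true hp1, map_measureReal_apply hm (measurableSet_singleton _), ← hlaw z]
      congr 1
      ext ω
      simp
    refine Measure.ext_of_measureReal_singleton fun b => ?_
    cases b with
    | true => exact ht
    | false =>
      have e : ({false} : Set Bool) = {true}ᶜ := by ext b; cases b <;> simp
      rw [e, probReal_compl_eq_one_sub (measurableSet_singleton _),
        probReal_compl_eq_one_sub (measurableSet_singleton _), ht]
  have h := (hind.comp (fun _ x => decide (x = -1)) fun _ =>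
    measurable_decide_eq_neg_one).map_fun_eq_pi_map
    fun z => (measurable_decide_eq_neg_one.comp (hX z)).aemeasurable
  simp only [Function.comp_def, hmap] at h
  exact h

variable {d n : ℕ} [NeZero n] {p : ℝ}

/-- The normalized vector of intrinsic volumes is a sum of locally dependent vectors, evaluated at
the random set of removed voxels. -/
lemma normalizedVolumes_eq_sum_siteVolume {Ω : Type*} [MeasurableSpace Ω] {P : Measure Ω}
    [IsProbabilityMeasure P] (hp0 : 0 < p) (hp1 : p < 1) {X : (Fin d → Fin n) → Ω → ℝ}
    (hX : ∀ z, Measurable (X z)) (hind : iIndepFun X P)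
    (hlaw : ∀ z, P.real {ω | X z ω = -1} = 1 - p) (ω : Ω) :
    normalizedVolumes P X ω
      = ∑ v : Fin d → Fin n, siteVolume (1 - p) v fun z => decide (X z ω = -1) := by
  have := isProbabilityMeasure_removalLaw hp0 hp1
  have hE : ∀ j : ℕ, ∫ ω', intrinsicVolume j (voxelComplex fun z => X z ω') ∂P
      = ∑ v : Fin d → Fin n, ∑ S : Finset (Fin d),
        openCubeVolume j S.card * (1 - (1 - p) ^ (cubeStar v S).card) := by
    intro j
    simp only [intrinsicVolume_voxelComplex]
    have h := integral_map (μ := P) (measurable_removal hX).aemeasurable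
      (f := fun η : (Fin d → Fin n) → Bool => ∑ v : Fin d → Fin n, ∑ S : Finset (Fin d),
        openCubeVolume j S.card * (1 - allTrue (cubeStar v S) η))
      Measurable.of_discrete.aestronglyMeasurable
    rw [← h, map_removal_eq_pi hp0 hp1 hX hind hlaw]
    simp only [integral_finsetSum _ fun _ _ => Integrable.of_finite, integral_const_mul]
    refine Finset.sum_congr rfl fun v _ => Finset.sum_congr rfl fun S _ => ?_
    rw [integral_sub .of_finite .of_finite, integral_allTrue (removalLaw_real_true hp1)]
    simp
  ext j
  simp only [normalizedVolumes, siteVolume, WithLp.ofLp_sum, Finset.sum_apply, ← Finset.mul_sum]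
  rw [hE, intrinsicVolume_voxelComplex]
  simp only [← Finset.sum_sub_distrib]
  congr 1
  refine Finset.sum_congr rfl fun v _ => Finset.sum_congr rfl fun S _ => ?_
  ring

/-- The constant of the rate of convergence, which depends on the dimension only. The first factor
is the cube of the bound for the rescaled contribution of a lattice vertex; the others come from the
Taylor bounds, the size of the dependency neighbourhoods and the number `d + 1` of components. -/
def rateConst (d : ℕ) : ℝ :=
  (∑ j : Fin (d + 1), ∑ S : Finset (Fin d), |openCubeVolume j S.card|) ^ 3
    * ((1 + (d + 1)) ^ 3 * (4 ^ d) ^ 2 * (5 * (1 + (d + 1)) ^ 2))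

lemma abs_integral_siteVolume_sub_le (hn : 3 ≤ n) (hp0 : 0 < p) (hp1 : p < 1)
    {g : EuclideanSpace ℝ (Fin (d + 1)) → ℝ} (hg : IsTestFunction g) :
    |(∫ ω, g (∑ v : Fin d → Fin n, siteVolume (1 - p) v ω)
        ∂(Measure.pi fun _ : Fin d → Fin n => removalLaw p))
      - ∫ y, g y ∂(multivariateGaussian 0 (covMatrix d p))|
      ≤ rateConst d / (n : ℝ) ^ ((d : ℝ) / 2) := by
  have := isProbabilityMeasure_removalLaw hp0 hp1
  have hq := removalLaw_real_true hp1
  have hT := hg.hasTaylorBounds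
  have hloc := isLocallyDependent_siteVolume (d := d) (n := n) hq
  set c := ∑ j : Fin (d + 1), ∑ S : Finset (Fin d), |openCubeVolume j S.card| with hc
  have hc0 : 0 ≤ c := Finset.sum_nonneg fun _ _ => Finset.sum_nonneg fun _ _ => abs_nonneg _
  have hn0 : (0 : ℝ) < n := by exact_mod_cast (by lia : 0 < n)
  -- the third power of the size of the summands beats their number by `n ^ (-d / 2)`
  have hscale : (n : ℝ) ^ d * ((n : ℝ) ^ (-(d : ℝ) / 2)) ^ 3 = ((n : ℝ) ^ ((d : ℝ) / 2))⁻¹ := by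
    rw [← Real.rpow_natCast, ← Real.rpow_natCast, ← Real.rpow_mul hn0.le, ← Real.rpow_add hn0,
      ← Real.rpow_neg hn0.le]
    congr 1
    push_cast
    ring
  have hibp : ApproxIntegrationByParts (Measure.pi fun _ : Fin d → Fin n => removalLaw p)
      (fun ω => ∑ v : Fin d → Fin n, siteVolume (1 - p) v ω) (covMatrix d p)
      ((1 + (Fintype.card (Fin (d + 1)) : ℝ)) ^ 3)
      (Fintype.card (Fin d → Fin n) * ((n : ℝ) ^ (-(d : ℝ) / 2) * c) ^ 3
        * ((1 + (Fintype.card (Fin (d + 1)) : ℝ)) ^ 3 * ((4 ^ d : ℕ) : ℝ) ^ 2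
          * (5 * (1 + (Fintype.card (Fin (d + 1)) : ℝ)) ^ 2))) := by
    intro g g₁ g₂ hg s hs0 hs1
    have h := hloc.abs_integral_inner_grad_sub_le hg (by positivity) (by positivity) hs0 hs1
    simp only [integral_sum_siteVolume_mul hn hp1 hq] at h
    exact h
  refine (hibp.abs_integral_sub_le (posSemidef_covMatrix hp0 hp1) hT (by positivity)).trans
    (le_of_eq ?_)
  rw [rateConst, ← hc, div_eq_mul_inv _ ((n : ℝ) ^ ((d : ℝ) / 2)), ← hscale]
  simp only [Fintype.card_pi, Fintype.card_fin, Finset.prod_const, Finset.card_univ]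
  push_cast
  ring

end Conclusion

section Distance

variable {d n : ℕ} {p : ℝ}

theorem dFour_map_normalizedVolumes_le (hn : 3 ≤ n) (hp0 : 0 < p) (hp1 : p < 1) {Ω : Type*}
    [MeasurableSpace Ω] {P : Measure Ω} [IsProbabilityMeasure P] {X : (Fin d → Fin n) → Ω → ℝ}
    (hX : ∀ z, Measurable (X z)) (hind : iIndepFun X P)
    (hlaw : ∀ z, P.real {ω | X z ω = -1} = 1 - p) :
    dFour (P.map (normalizedVolumes P X)) (multivariateGaussian 0 (covMatrix d p))
      ≤ ENNReal.ofReal (rateConst d / (n : ℝ) ^ ((d : ℝ) / 2)) := by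
  have : NeZero n := ⟨by lia⟩
  refine iSup₂_le fun g hg => ENNReal.ofReal_le_ofReal ?_
  have hV : normalizedVolumes P X = (fun η : (Fin d → Fin n) → Bool =>
      ∑ v : Fin d → Fin n, siteVolume (1 - p) v η) ∘ fun ω z => decide (X z ω = -1) :=
    funext (normalizedVolumes_eq_sum_siteVolume hp0 hp1 hX hind hlaw)
  rw [hV, ← Measure.map_map Measurable.of_discrete (measurable_removal hX),
    map_removal_eq_pi hp0 hp1 hX hind hlaw,
    integral_map Measurable.of_discrete.aemeasurable
      hg.hasTaylorBounds.continuous.aestronglyMeasurable]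
  exact abs_integral_siteVolume_sub_le hn hp0 hp1 hg

end Distance

end RandomCubical
end

theorem mainTheorem5 (d : ℕ) (hd : 1 ≤ d) (p : ℝ) (hp0 : 0 < p) (hp1 : p < 1) :
    (RandomCubical.covMatrix d p).PosSemidef ∧
    ∃ C : ℝ, ∀ n : ℕ, 3 ≤ n →
      ∀ (Ω : Type*) [MeasurableSpace Ω] (P : Measure Ω) [IsProbabilityMeasure P]
        (X : (Fin d → Fin n) → Ω → ℝ),
        (∀ z, Measurable (X z)) → iIndepFun X P →
        (∀ z, P.real {ω | X z ω = 1} = p) → (∀ z, P.real {ω | X z ω = -1} = 1 - p) →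
        RandomCubical.dFour (P.map (RandomCubical.normalizedVolumes P X))
            (multivariateGaussian 0 (RandomCubical.covMatrix d p)) ≤
          ENNReal.ofReal (C / (n : ℝ) ^ ((d : ℝ) / 2)) := by
  exact ⟨RandomCubical.posSemidef_covMatrix hp0 hp1, RandomCubical.rateConst d,
    fun n hn Ω _ P _ X hX hind _ hlaw =>
      RandomCubical.dFour_map_normalizedVolumes_le hn hp0 hp1 hX hind hlaw⟩
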